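/- Fix $\beta\in(0,\infty)$. The linear reliability channel (LRC) with parameter $\beta$ takes an input $X^n\in\{0,1\}^n$ and draws a permutation $T$ of $\{1,\dots,n\}$ uniformly at random with each use. Given $T=\tau$, the bits are flipped independently, bit $i$ with probability $q_{\tau(i)}$, where $q_j=\frac{e^{-\beta j/n}}{1+e^{-\beta j/n}}$; the output is $Y^n\in\{0,1\}^n$. A soft-decision decoder observes $Y^n$ and $T$; a hard-decision decoder observes only $Y^n$ and knows that $T$ is uniform. Let $N^n$ be distributed as the noise effect $X^n+Y^n$ (addition modulo 2) given $T=\tau$, and let $Z^n$ be distributed as $X^n+Y^n$ with $T$ uniform. Let $H_1(N)$ and $H_1(Z)$ be the Shannon entropy rates in bits, $H_1(N)=\lim_n \frac1n H(N^n)$ (the same for all realizations $\tau=\tau_n$) and $H_1(Z)=\lim_n\frac1n H(Z^n)$, and let $C_N=1-H_1(N)$ and $C_Z=1-H_1(Z)$ be the soft- and hard-decision capacities; these limits exist. For a rate $R$, consider random codes with $M_n$ independent, uniformly distributed code words in $\{0,1\}^n$, where $M_n\ge 1$ for all $n$, $M_n\ge 2$ for all large $n$, and $\frac1n\log_2 M_n\to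 R$, and a uniformly distributed message. A maximum-likelihood (ML) decoder returns a code word $c$ that maximizes $p(Y^n\mid c,T)$ (soft-decision) or $p(Y^n\mid c)$ (hard-decision), ties being broken in any way. Let $P_{\mathrm{err}}(n)$ be the probability that the decoded word is not the transmitted code word, and $P_{\mathrm{suc}}(n)=1-P_{\mathrm{err}}(n)$. The error exponent is $\epsilon(R)=-\lim_n\frac1n\log_2 P_{\mathrm{err}}(n)$ and the success exponent is $s(R)=-\lim_n\frac1n\log_2P_{\mathrm{suc}}(n)$, written $\epsilon_N,s_N$ for soft-decision and $\epsilon_Z,s_Z$ for hard-decision ML decoding. 1. For every $R\in[0,C_Z]$, the exponents $\epsilon_N(R)$ and $\epsilon_Z(R)$ exist as finite limits that depend only on $\beta$ and $R$ (not on $(M_n)$ or on the tie-breaking), and $\epsilon_N(R)>\epsilon_Z(R)$. 2. For every $R\in[C_N,1)$, the exponents $s_N(R)$ and $s_Z(R)$ exist as finite limits that depend only on $\beta$ and $R$ (not on $(M_n)$ or on the tie-breaking), and $s_N(R)<s_Z(R)$. -/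

import Mathlib

open Filter Topology
open scoped BigOperators

namespace LRC

/-- Binary words of length `n`; addition is bitwise modulo two. -/
abbrev Word (n : ℕ) : Type := Fin n → ZMod 2

/-- Codebooks with `M` (not necessarily distinct) code words of length `n`. -/
abbrev Codebook (M n : ℕ) : Type := Fin M → Word n

/-- The bit-flip probability `q_i = e^{-β i / n} / (1 + e^{-β i / n})`, `i = 1, …, n`; the
index `i` is `(j : ℕ) + 1` for `j : Fin n`. -/
noncomputable def flipProb (β : ℝ) (n : ℕ) (j : Fin n) : ℝ :=
  Real.exp (-β * ((j : ℕ) + 1) / n) / (1 + Real.exp (-β * ((j : ℕ) + 1) / n))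

/-- The transition probability `p(y ∣ x, τ)` of the linear reliability channel given that the
reliability ordering permutation is `τ`: independently over `i`, bit `i` is flipped with
probability `q_{τ(i)}`. -/
noncomputable def softLaw (β : ℝ) {n : ℕ} (τ : Equiv.Perm (Fin n)) (x y : Word n) : ℝ :=
  ∏ i, if y i ≠ x i then flipProb β n (τ i) else 1 - flipProb β n (τ i)

/-- The transition probability `p(y ∣ x)` seen without knowledge of the (uniformly distributed)
reliability ordering permutation. -/
noncomputable def hardLaw (β : ℝ) {n : ℕ} (x y : Word n) : ℝ :=
  𝔼 τ : Equiv.Perm (Fin n), softLaw β τ x y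

/-- The soft-decision noise effect: the law of `X + Y` given `T = τ`. It does not depend on the
input (`softLaw_add`), so the input is taken to be `0`. -/
noncomputable def softNoise (β : ℝ) {n : ℕ} (τ : Equiv.Perm (Fin n)) (z : Word n) : ℝ :=
  softLaw β τ 0 z

/-- The hard-decision noise effect: the law of `X + Y` when `T` is uniformly distributed. -/
noncomputable def hardNoise (β : ℝ) {n : ℕ} (z : Word n) : ℝ :=
  hardLaw β 0 z

/-- Whatever the input `x`, the output is `x + z` with probability `softNoise β τ z`. -/
theorem softLaw_add (β : ℝ) {n : ℕ} (τ : Equiv.Perm (Fin n)) (x z : Word n) :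
    softLaw β τ x (x + z) = softNoise β τ z := by
  simp [softLaw, softNoise]

/-- Whatever the input `x`, the output is `x + z` with probability `hardNoise β z`. -/
theorem hardLaw_add (β : ℝ) {n : ℕ} (x z : Word n) :
    hardLaw β x (x + z) = hardNoise β z := by
  simp [hardLaw, hardNoise, softLaw_add, softNoise]

/-- Shannon entropy, in bits, of a probability mass function on a finite type. -/
noncomputable def entropyBits {α : Type*} [Fintype α] (p : α → ℝ) : ℝ :=
  (∑ a, Real.negMulLog (p a)) / Real.log 2

/-- `h` is the Shannon entropy rate `H₁(N)`, in bits, of the soft-decision noise effect, for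
whatever realizations of the reliability ordering permutations. -/
def IsSoftEntropyRate (β h : ℝ) : Prop :=
  ∀ τ : (n : ℕ) → Equiv.Perm (Fin n),
    Tendsto (fun n : ℕ => entropyBits (softNoise β (τ n)) / n) atTop (𝓝 h)

/-- `h` is the Shannon entropy rate `H₁(Z)`, in bits, of the hard-decision noise effect. -/
def IsHardEntropyRate (β h : ℝ) : Prop :=
  Tendsto (fun n : ℕ => entropyBits (hardNoise β (n := n)) / n) atTop (𝓝 h)

/-- `C` is the soft-decision capacity `C_N = 1 - H₁(N)`. -/
def IsSoftCapacity (β C : ℝ) : Prop := IsSoftEntropyRate β (1 - C)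

/-- `C` is the hard-decision capacity `C_Z = 1 - H₁(Z)`. -/
def IsHardCapacity (β C : ℝ) : Prop := IsHardEntropyRate β (1 - C)

/-- A soft-decision decoder: it sees the codebook, the reliability ordering permutation and the
received word, and returns a word. -/
abbrev SoftDecoder (M n : ℕ) : Type := Codebook M n → Equiv.Perm (Fin n) → Word n → Word n

/-- A hard-decision decoder: it does not see the reliability ordering permutation. -/
abbrev HardDecoder (M n : ℕ) : Type := Codebook M n → Word n → Word n

/-- A hard-decision decoder, as a decoder that ignores the reliability ordering. -/
def HardDecoder.toSoft {M n : ℕ} (D : HardDecoder M n) : SoftDecoder M n := fun C _ y => D C y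

/-- Soft-decision maximum-likelihood decoding, with any rule for breaking ties. -/
def IsSoftML (β : ℝ) {M n : ℕ} (D : SoftDecoder M n) : Prop :=
  ∀ C τ y, D C τ y ∈ Set.range C ∧ ∀ m, softLaw β τ (C m) y ≤ softLaw β τ (D C τ y) y

/-- Hard-decision maximum-likelihood decoding, with any rule for breaking ties. -/
def IsHardML (β : ℝ) {M n : ℕ} (D : HardDecoder M n) : Prop :=
  ∀ C y, D C y ∈ Set.range C ∧ ∀ m, hardLaw β (C m) y ≤ hardLaw β (D C y) y

/-- The probability that the decoded word is not the transmitted code word, when the `M` code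
words are independent and uniform, the message is uniform, and the permutation is uniform. -/
noncomputable def errorProb (β : ℝ) {M n : ℕ} (D : SoftDecoder M n) : ℝ :=
  𝔼 C : Codebook M n, 𝔼 m : Fin M, 𝔼 τ : Equiv.Perm (Fin n),
    ∑ y : Word n, if D C τ y ≠ C m then softLaw β τ (C m) y else 0

/-- The probability that the decoded word is the transmitted code word, in the same setting. -/
noncomputable def successProb (β : ℝ) {M n : ℕ} (D : SoftDecoder M n) : ℝ :=
  𝔼 C : Codebook M n, 𝔼 m : Fin M, 𝔼 τ : Equiv.Perm (Fin n),
    ∑ y : Word n, if D C τ y = C m then softLaw β τ (C m) y else 0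

/-- `M n` is the number of code words at block length `n`, and the code rate is `R`. At least two
code words are required for large `n`: with a single one (possible only for `R = 0`) nothing has
to be decoded. -/
def IsCodeSize (R : ℝ) (M : ℕ → ℕ) : Prop :=
  (∀ n, 1 ≤ M n) ∧ (∀ᶠ n in atTop, 2 ≤ M n) ∧
    Tendsto (fun n : ℕ => Real.logb 2 (M n) / n) atTop (𝓝 R)

/-- `e = - lim (1 / n) log₂ (p n)`, with `p n` positive for large `n`. -/
def HasExponent (p : ℕ → ℝ) (e : ℝ) : Prop :=
  (∀ᶠ n in atTop, 0 < p n) ∧ Tendsto (fun n : ℕ => -(Real.logb 2 (p n) / n)) atTop (𝓝 e)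

/-- `e` is the error exponent at rate `R` of random codes under soft-decision ML decoding. -/
def IsSoftErrorExponent (β R e : ℝ) : Prop :=
  ∀ M, IsCodeSize R M → ∀ D : (n : ℕ) → SoftDecoder (M n) n, (∀ n, IsSoftML β (D n)) →
    HasExponent (fun n => errorProb β (D n)) e

/-- `e` is the error exponent at rate `R` of random codes under hard-decision ML decoding. -/
def IsHardErrorExponent (β R e : ℝ) : Prop :=
  ∀ M, IsCodeSize R M → ∀ D : (n : ℕ) → HardDecoder (M n) n, (∀ n, IsHardML β (D n)) →
    HasExponent (fun n => errorProb β (D n).toSoft) e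

/-- `s` is the success exponent at rate `R` of random codes under soft-decision ML decoding. -/
def IsSoftSuccessExponent (β R s : ℝ) : Prop :=
  ∀ M, IsCodeSize R M → ∀ D : (n : ℕ) → SoftDecoder (M n) n, (∀ n, IsSoftML β (D n)) →
    HasExponent (fun n => successProb β (D n)) s

/-- `s` is the success exponent at rate `R` of random codes under hard-decision ML decoding. -/
def IsHardSuccessExponent (β R s : ℝ) : Prop :=
  ∀ M, IsCodeSize R M → ∀ D : (n : ℕ) → HardDecoder (M n) n, (∀ n, IsHardML β (D n)) →
    HasExponent (fun n => successProb β (D n).toSoft) s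

end LRC

namespace LRC

/-! Given the permutation, the noise bits are independent and the bit of rank `t = j / n` has logit
`-β t`. A soft ML decoder therefore minimizes a linear score of the noise with weight `c t = t`. The
averaged hard likelihood depends on the Hamming weight alone and is strictly decreasing in it, so a
hard ML decoder minimizes the score with `c = 1`. Seen from the received word, the other code words
are `M - 1` independent uniform guesses. Decoding succeeds if all of them score strictly above the
noise, and only if none scores strictly below. Both bounds have the same exponent, so ties do not
matter.

For either weight `c`, let `φ t = -β t` and work in nats. Tilt the noise to logits `φ + a c` and the
guesses to `-θ c`, with equal mean scores; `rate` is the relative entropy per bit of a tilted law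
from the original one. Below capacity, the error exponent is `rate φ c a + ρ (rate 0 c (-θ) - R)`
with `a = ρ θ` and `0 ≤ ρ ≤ 1`, where `ρ = 1` or the bracket vanishes (`hasRate_error`). Above
capacity, the noise must be so light that `M` guesses hardly reach it: `rate 0 c (-θ) = R` and the
success exponent is `rate φ c a` with `a ≤ 0` (`hasRate_success`).

Soft and hard are compared through supporting lines: by convexity of softplus, `b m - Λ b` is at
most the relative entropy from `φ` of any law with mean score `m`, strictly unless that law is the
tilt by `b` (`tangent_le`, `tangent_lt`). For errors, `a = ρ θ` cancels the mean score from the hard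
exponent, which can thus be tested on the soft optimum, a law `-θs t` that is not of the form `-θ`
(`hard_error_rate_lt`). For successes, the hard optimum `-β t + a` is tested against lines of both
problems (`soft_success_rate_lt`). -/

/-! ### Convexity estimates for softplus -/

/-- The softplus function, the log-partition function of a Bernoulli variable with logit `u`. -/
noncomputable def softplus (u : ℝ) : ℝ := Real.log (1 + Real.exp u)

theorem one_add_exp_pos (u : ℝ) : 0 < 1 + Real.exp u := by positivity

theorem exp_softplus (u : ℝ) : Real.exp (softplus u) = 1 + Real.exp u :=
  Real.exp_log (one_add_exp_pos u)

theorem softplus_zero : softplus 0 = Real.log 2 := by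
  norm_num [softplus]

@[fun_prop]
theorem continuous_softplus : Continuous softplus := by
  unfold softplus
  exact (by fun_prop : Continuous fun u => 1 + Real.exp u).log fun u => (one_add_exp_pos u).ne'

attribute [fun_prop] continuous_sigmoid

theorem sigmoid_eq_exp_div (u : ℝ) : Real.sigmoid u = Real.exp u / (1 + Real.exp u) := by
  rw [Real.sigmoid_def, Real.exp_neg]
  field_simp
  ring

/-- The factor `1 + σ(v) (exp h - 1)` is the moment generating function of a bit with logit `v`. The
three estimates that follow rest on it. -/
theorem one_add_exp_shift (v h : ℝ) :
    1 + Real.exp (v + h) = (1 + Real.exp v) * (1 + Real.sigmoid v * (Real.exp h - 1)) := by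
  rw [sigmoid_eq_exp_div, Real.exp_add]
  field_simp
  ring

/-- The tangent line inequality for the softplus function. -/
theorem softplus_tangent_le (u v : ℝ) :
    softplus v + (u - v) * Real.sigmoid v ≤ softplus u := by
  have h := convexOn_exp.2 (Set.mem_univ (u - v)) (Set.mem_univ 0) (Real.sigmoid_nonneg v)
    (sub_nonneg.2 (Real.sigmoid_le_one v)) (by ring)
  have e := one_add_exp_shift v (u - v)
  rw [← Real.exp_le_exp, Real.exp_add, exp_softplus, exp_softplus]
  simp only [smul_eq_mul, mul_zero, add_zero, Real.exp_zero, mul_one] at h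
  rw [add_sub_cancel] at e
  rw [e, mul_comm (u - v)]
  exact mul_le_mul_of_nonneg_left (by linarith) (one_add_exp_pos v).le

theorem softplus_tangent_lt {u v : ℝ} (huv : u ≠ v) :
    softplus v + (u - v) * Real.sigmoid v < softplus u := by
  have h := strictConvexOn_exp.2 (Set.mem_univ (u - v)) (Set.mem_univ 0) (sub_ne_zero.2 huv)
    (Real.sigmoid_pos v) (sub_pos.2 (Real.sigmoid_lt_one v)) (by ring)
  have e := one_add_exp_shift v (u - v)
  rw [← Real.exp_lt_exp, Real.exp_add, exp_softplus, exp_softplus]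
  simp only [smul_eq_mul, mul_zero, add_zero, Real.exp_zero, mul_one] at h
  rw [add_sub_cancel] at e
  rw [e, mul_comm (u - v)]
  exact mul_lt_mul_of_pos_left (by linarith) (one_add_exp_pos v)

/-- A crude second-order Taylor bound, from `|exp h - 1 - h| ≤ h ^ 2`; being uniform in `v`, it
serves all bits at once. -/
theorem softplus_add_le (v : ℝ) {h : ℝ} (hh : |h| ≤ 1) :
    softplus (v + h) ≤ softplus v + h * Real.sigmoid v + h ^ 2 := by
  have e1 := (abs_le.1 (Real.abs_exp_sub_one_sub_id_le hh)).2
  have s0 := Real.sigmoid_nonneg v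
  have s1 := Real.sigmoid_le_one v
  have e2 : 1 + Real.sigmoid v * (Real.exp h - 1)
      ≤ Real.exp (h * Real.sigmoid v + h ^ 2) := by
    refine le_trans ?_ (Real.add_one_le_exp _)
    nlinarith [sq_nonneg h]
  rw [← Real.exp_le_exp, exp_softplus, one_add_exp_shift, add_assoc, Real.exp_add (softplus v),
    exp_softplus]
  exact mul_le_mul_of_nonneg_left e2 (one_add_exp_pos v).le

/-! ### Independent bits and exponential tilting -/

/-- The total weight `∑ c i` of the positions at which the word `z` is nonzero. -/
noncomputable def score {n : ℕ} (c : Fin n → ℝ) (z : Word n) : ℝ :=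
  ∑ i, if z i ≠ 0 then c i else 0

theorem score_add {n : ℕ} (c d : Fin n → ℝ) (z : Word n) :
    score (fun i => c i + d i) z = score c z + score d z := by
  rw [score, score, score, ← Finset.sum_add_distrib]
  exact Finset.sum_congr rfl fun i _ => by split_ifs <;> simp

theorem score_mul {n : ℕ} (b : ℝ) (c : Fin n → ℝ) (z : Word n) :
    score (fun i => b * c i) z = b * score c z := by
  rw [score, score, Finset.mul_sum]
  exact Finset.sum_congr rfl fun i _ => by split_ifs <;> simp

theorem score_comp_perm {n : ℕ} (c : Fin n → ℝ) (z : Word n) (τ : Equiv.Perm (Fin n)) :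
    score (c ∘ τ) z = score c (z ∘ τ.symm) := by
  simp only [score]
  exact Fintype.sum_equiv τ _ _ fun i => by simp

/-- The law of a word with independent bits, bit `i` being nonzero with logit `ψ i`. -/
noncomputable def gibbs {n : ℕ} (ψ : Fin n → ℝ) (z : Word n) : ℝ :=
  Real.exp (score ψ z - ∑ i, softplus (ψ i))

theorem gibbs_pos {n : ℕ} (ψ : Fin n → ℝ) (z : Word n) : 0 < gibbs ψ z := Real.exp_pos _

theorem gibbs_comp_perm {n : ℕ} (ψ : Fin n → ℝ) (z : Word n) (τ : Equiv.Perm (Fin n)) :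
    gibbs (ψ ∘ τ) z = gibbs ψ (z ∘ τ.symm) := by
  rw [gibbs, gibbs, score_comp_perm]
  congr 2
  exact Equiv.sum_comp τ fun i => softplus (ψ i)

theorem gibbs_zero {n : ℕ} (z : Word n) : gibbs (fun _ => 0) z = ((2 : ℝ) ^ n)⁻¹ := by
  simp [gibbs, score, softplus_zero, Real.exp_neg, Real.exp_nat_mul, Real.exp_log]

theorem gibbs_eq_prod {n : ℕ} (ψ : Fin n → ℝ) (z : Word n) :
    gibbs ψ z = ∏ i, if z i ≠ 0 then Real.sigmoid (ψ i) else 1 - Real.sigmoid (ψ i) := by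
  rw [gibbs, score, ← Finset.sum_sub_distrib, Real.exp_sum]
  refine Finset.prod_congr rfl fun i _ => ?_
  rw [Real.exp_sub, exp_softplus, sigmoid_eq_exp_div]
  have := one_add_exp_pos (ψ i)
  split_ifs
  · rfl
  · rw [Real.exp_zero]
    field_simp
    ring

theorem sum_exp_score {n : ℕ} (ψ : Fin n → ℝ) :
    ∑ z : Word n, Real.exp (score ψ z) = Real.exp (∑ i, softplus (ψ i)) := by
  have h := Finset.prod_univ_sum (fun _ : Fin n => (Finset.univ : Finset (ZMod 2)))
    (fun i b => Real.exp (if b ≠ 0 then ψ i else 0))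
  rw [Real.exp_sum]
  simp only [score, Real.exp_sum]
  rw [Fintype.piFinset_univ] at h
  rw [← h]
  refine Finset.prod_congr rfl fun i _ => ?_
  rw [exp_softplus]
  have : (Finset.univ : Finset (ZMod 2)) = {0, 1} := rfl
  rw [this, Finset.sum_pair (by decide)]
  simp

/-- Expectation of `f` under the law of independent bits with logits `ψ`. -/
noncomputable def mean {n : ℕ} (ψ : Fin n → ℝ) (f : Word n → ℝ) : ℝ :=
  ∑ z, gibbs ψ z * f z

/-- Probability of `A` under the law of independent bits with logits `ψ`. -/
noncomputable def prob {n : ℕ} (ψ : Fin n → ℝ) (A : Set (Word n)) : ℝ :=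
  mean ψ (A.indicator 1)

theorem mean_mono {n : ℕ} (ψ : Fin n → ℝ) {f g : Word n → ℝ} (h : ∀ z, f z ≤ g z) :
    mean ψ f ≤ mean ψ g :=
  Finset.sum_le_sum fun z _ => mul_le_mul_of_nonneg_left (h z) (gibbs_pos ψ z).le

theorem mean_add {n : ℕ} (ψ : Fin n → ℝ) (f g : Word n → ℝ) :
    mean ψ (fun z => f z + g z) = mean ψ f + mean ψ g := by
  simp [mean, mul_add, Finset.sum_add_distrib]

theorem mean_sub {n : ℕ} (ψ : Fin n → ℝ) (f g : Word n → ℝ) :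
    mean ψ (fun z => f z - g z) = mean ψ f - mean ψ g := by
  simp [mean, mul_sub, Finset.sum_sub_distrib]

theorem mean_const_mul {n : ℕ} (ψ : Fin n → ℝ) (a : ℝ) (f : Word n → ℝ) :
    mean ψ (fun z => a * f z) = a * mean ψ f := by
  simp only [mean, Finset.mul_sum]
  exact Finset.sum_congr rfl fun z _ => by ring

/-- Weighting by `exp (b * score c)` shifts the logits from `ψ` to `ψ + b c`, so the exponential
moment is a quotient of partition functions. -/
theorem mean_exp_score {n : ℕ} (ψ c : Fin n → ℝ) (b : ℝ) :
    mean ψ (fun z => Real.exp (b * score c z))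
      = Real.exp (∑ i, (softplus (ψ i + b * c i) - softplus (ψ i))) := by
  rw [Finset.sum_sub_distrib, Real.exp_sub, ← sum_exp_score, mean, Finset.sum_div]
  refine Finset.sum_congr rfl fun z _ => ?_
  rw [score_add, score_mul, Real.exp_add, gibbs, Real.exp_sub]
  ring

theorem sum_gibbs {n : ℕ} (ψ : Fin n → ℝ) : ∑ z, gibbs ψ z = 1 := by
  have := mean_exp_score ψ 0 0
  simpa [mean] using this

theorem mean_const {n : ℕ} (ψ : Fin n → ℝ) (a : ℝ) : mean ψ (fun _ => a) = a := by
  simp [mean, ← Finset.sum_mul, sum_gibbs]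

theorem mean_comp_perm {n : ℕ} (ψ : Fin n → ℝ) (f : Word n → ℝ) (τ : Equiv.Perm (Fin n)) :
    mean (ψ ∘ τ) (fun z => f (z ∘ τ.symm)) = mean ψ f := by
  simp only [mean, gibbs_comp_perm]
  exact Fintype.sum_equiv (Equiv.arrowCongr τ (Equiv.refl _)) _ _ fun z => rfl

theorem prob_nonneg {n : ℕ} (ψ : Fin n → ℝ) (A : Set (Word n)) : 0 ≤ prob ψ A :=
  Finset.sum_nonneg fun z _ => mul_nonneg (gibbs_pos ψ z).le
    (Set.indicator_nonneg (fun _ _ => zero_le_one) z)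

theorem prob_mono {n : ℕ} (ψ : Fin n → ℝ) {A B : Set (Word n)} (h : A ⊆ B) :
    prob ψ A ≤ prob ψ B :=
  mean_mono ψ fun z => Set.indicator_le_indicator_of_subset h (fun _ => zero_le_one) z

theorem prob_univ {n : ℕ} (ψ : Fin n → ℝ) : prob ψ Set.univ = 1 := by
  rw [prob, Set.indicator_univ]
  exact mean_const ψ 1

theorem prob_le_one {n : ℕ} (ψ : Fin n → ℝ) (A : Set (Word n)) : prob ψ A ≤ 1 :=
  (prob_mono ψ (Set.subset_univ A)).trans_eq (prob_univ ψ)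

theorem prob_compl {n : ℕ} (ψ : Fin n → ℝ) (A : Set (Word n)) :
    prob ψ Aᶜ = 1 - prob ψ A := by
  rw [← prob_univ ψ, prob, prob, prob, ← mean_sub]
  congr 1
  funext z
  by_cases hz : z ∈ A <;> simp [hz]

theorem prob_union_le {n : ℕ} (ψ : Fin n → ℝ) (A B : Set (Word n)) :
    prob ψ (A ∪ B) ≤ prob ψ A + prob ψ B := by
  rw [prob, prob, prob, ← mean_add]
  refine mean_mono ψ fun z => ?_
  by_cases hA : z ∈ A <;> by_cases hB : z ∈ B <;> simp [hA, hB]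

theorem prob_comp_perm {n : ℕ} (ψ : Fin n → ℝ) (A : Set (Word n)) (τ : Equiv.Perm (Fin n)) :
    prob (ψ ∘ τ) ((fun z : Word n => z ∘ τ.symm) ⁻¹' A) = prob ψ A := by
  rw [prob, prob, ← mean_comp_perm ψ _ τ]
  rfl

/-- Markov's inequality for exponential moments. -/
theorem prob_le_exp_moment {n : ℕ} (ψ c : Fin n → ℝ) (b t : ℝ) {A : Set (Word n)}
    (hA : ∀ z ∈ A, t ≤ b * score c z) :
    prob ψ A ≤ Real.exp (∑ i, (softplus (ψ i + b * c i) - softplus (ψ i)) - t) := by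
  rw [sub_eq_add_neg, Real.exp_add, ← mean_exp_score, mul_comm, ← mean_const_mul]
  refine mean_mono ψ fun z => ?_
  rw [← Real.exp_add]
  by_cases hz : z ∈ A
  · rw [Set.indicator_of_mem hz]
    exact Real.one_le_exp (by linarith [hA z hz])
  · rw [Set.indicator_of_notMem hz]
    positivity

/-- Change of measure by exponential tilting. -/
theorem exp_mul_prob_le {n : ℕ} (ψ c : Fin n → ℝ) (b t : ℝ) {A : Set (Word n)}
    (hA : ∀ z ∈ A, b * score c z ≤ t) :
    Real.exp (∑ i, (softplus (ψ i + b * c i) - softplus (ψ i)) - t)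
      * prob (fun i => ψ i + b * c i) A ≤ prob ψ A := by
  rw [prob, ← mean_const_mul, prob, mean, mean]
  refine Finset.sum_le_sum fun z _ => ?_
  by_cases hz : z ∈ A
  · rw [Set.indicator_of_mem hz]
    simp only [Pi.one_apply, mul_one, gibbs, ← Real.exp_add]
    rw [Real.exp_le_exp, score_add, score_mul, Finset.sum_sub_distrib]
    linarith [hA z hz]
  · simp [Set.indicator_of_notMem hz]

/-- A one-sided deviation bound for the score of independent bits. -/
theorem prob_deviation_le {n : ℕ} (ψ c : Fin n → ℝ) {K s δ : ℝ}
    (hc : ∀ i, |c i| ≤ K) (hK : |s| * K ≤ 1) :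
    prob ψ {z | s * ∑ i, c i * Real.sigmoid (ψ i) + n * δ ≤ s * score c z}
      ≤ Real.exp (n * ((s * K) ^ 2 - δ)) := by
  refine (prob_le_exp_moment ψ c s _ fun z hz => hz).trans (Real.exp_le_exp.2 ?_)
  have h : ∑ i, (softplus (ψ i + s * c i) - softplus (ψ i))
      ≤ ∑ i, (s * (c i * Real.sigmoid (ψ i)) + (s * K) ^ 2) := by
    refine Finset.sum_le_sum fun i _ => ?_
    have h1 : |s * c i| ≤ |s| * K := by
      rw [abs_mul]
      exact mul_le_mul_of_nonneg_left (hc i) (abs_nonneg s)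
    have h2 := softplus_add_le (ψ i) (h1.trans hK)
    have h3 : (s * c i) ^ 2 ≤ (s * K) ^ 2 := by
      rw [← sq_abs, ← sq_abs (s * K), abs_mul s K]
      exact pow_le_pow_left₀ (abs_nonneg _)
        (h1.trans (mul_le_mul_of_nonneg_left (le_abs_self K) (abs_nonneg s))) 2
    linarith
  rw [Finset.sum_add_distrib, ← Finset.mul_sum] at h
  simp only [Finset.sum_const, Finset.card_univ, Fintype.card_fin, nsmul_eq_mul] at h
  linarith

/-- The expected value of the score. -/
theorem mean_score {n : ℕ} (ψ c : Fin n → ℝ) :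
    mean ψ (score c) = ∑ i, c i * Real.sigmoid (ψ i) := by
  have key : ∀ i, mean ψ (fun z => if z i ≠ 0 then (1 : ℝ) else 0) = Real.sigmoid (ψ i) := by
    intro i
    -- With weight `log 2` on bit `i` alone, the exponential is `1` plus the indicator of that bit,
    -- so the moment formula yields its mean without differentiation.
    have h := mean_exp_score ψ (Pi.single i 1) (Real.log 2)
    have h1 : ∀ z : Word n, Real.exp (Real.log 2 * score (Pi.single i 1) z)
        = 1 + if z i ≠ 0 then (1 : ℝ) else 0 := by
      intro z
      have : score (Pi.single i 1) z = if z i ≠ 0 then (1 : ℝ) else 0 := by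
        rw [score, Finset.sum_eq_single i]
        · simp
        · intro j _ hj
          simp [hj]
        · simp
      rw [this]
      split_ifs
      · rw [mul_one, Real.exp_log two_pos]
        norm_num
      · simp
    simp only [h1] at h
    rw [mean_add, mean_const, Finset.sum_eq_single i] at h
    · have h2 := one_add_exp_pos (ψ i)
      simp only [Pi.single_eq_same, mul_one, Real.exp_sub, exp_softplus, Real.exp_add,
        Real.exp_log two_pos] at h
      rw [sigmoid_eq_exp_div]
      field_simp at h ⊢
      linarith
    · intro j _ hj
      simp [hj]
    · simp
  have : score c = fun z => ∑ i, c i * if z i ≠ 0 then (1 : ℝ) else 0 := by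
    funext z
    exact Finset.sum_congr rfl fun i _ => by simp
  rw [this]
  simp only [mean, Finset.mul_sum]
  rw [Finset.sum_comm]
  refine Finset.sum_congr rfl fun i _ => ?_
  rw [← key i, mean, Finset.mul_sum]
  exact Finset.sum_congr rfl fun z _ => by ring

/-! ### Riemann sums and limiting functionals -/

/-- The values of `f` at the grid points `1 / n, 2 / n, …, 1`. -/
noncomputable def sample (f : ℝ → ℝ) (n : ℕ) (j : Fin n) : ℝ := f (((j : ℕ) + 1) / n)

theorem grid_mem_Icc {n : ℕ} (j : Fin n) : (((j : ℕ) : ℝ) + 1) / n ∈ Set.Icc (0 : ℝ) 1 := by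
  have h : ((j : ℕ) : ℝ) + 1 ≤ n := by exact_mod_cast j.2
  have hn : (0 : ℝ) < n := by linarith [(Nat.cast_nonneg (j : ℕ) : (0 : ℝ) ≤ (j : ℕ))]
  exact ⟨by positivity, (div_le_one hn).2 h⟩

/-- Riemann sums of a continuous function converge to its integral. -/
theorem tendsto_sum_sample_div {f : ℝ → ℝ} (hf : Continuous f) :
    Tendsto (fun n : ℕ => (∑ j, sample f n j) / n) atTop (𝓝 (∫ t in (0 : ℝ)..1, f t)) := by
  rw [Metric.tendsto_atTop]
  intro ε hε
  have huc := (isCompact_Icc (a := (0 : ℝ)) (b := 1)).uniformContinuousOn_of_continuous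
    hf.continuousOn
  obtain ⟨δ, hδ, hfδ⟩ := Metric.uniformContinuousOn_iff.1 huc (ε / 2) (by positivity)
  obtain ⟨N, hN⟩ := exists_nat_gt (1 / δ)
  refine ⟨N + 1, fun n hn => ?_⟩
  have hn0 : (0 : ℝ) < n := by exact_mod_cast Nat.lt_of_lt_of_le (Nat.succ_pos N) hn
  have hnN : (N : ℝ) + 1 ≤ n := by exact_mod_cast hn
  have hnδ : 1 / (n : ℝ) < δ := by
    rw [div_lt_iff₀ hδ] at hN
    rw [div_lt_iff₀ hn0]
    nlinarith
  have hint : ∀ a b : ℝ, IntervalIntegrable f MeasureTheory.volume a b := fun a b =>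
    hf.intervalIntegrable a b
  have hsum := intervalIntegral.sum_integral_adjacent_intervals (μ := MeasureTheory.volume)
    (f := f) (a := fun k : ℕ => (k : ℝ) / n) (n := n) fun k _ => hint _ _
  simp only [Nat.cast_zero, zero_div, div_self hn0.ne'] at hsum
  rw [dist_eq_norm, ← hsum, Finset.sum_div, ← Fin.sum_univ_eq_sum_range
    (fun k : ℕ => ∫ t in ((k : ℝ) / n)..(((k + 1 : ℕ) : ℝ) / n), f t), ← Finset.sum_sub_distrib]
  have hterm : ∀ j : Fin n, ‖sample f n j / n
      - ∫ t in (((j : ℕ) : ℝ) / n)..((((j : ℕ) + 1 : ℕ) : ℝ) / n), f t‖ ≤ ε / 2 / n := by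
    intro j
    have hlen : (((j : ℕ) + 1 : ℕ) : ℝ) / n - ((j : ℕ) : ℝ) / n = 1 / n := by
      push_cast
      ring
    have hle : ((j : ℕ) : ℝ) / n ≤ (((j : ℕ) + 1 : ℕ) : ℝ) / n := by
      have : (0 : ℝ) < 1 / n := by positivity
      linarith
    have hc : sample f n j / n
        = ∫ _ in (((j : ℕ) : ℝ) / n)..((((j : ℕ) + 1 : ℕ) : ℝ) / n), sample f n j := by
      rw [intervalIntegral.integral_const, hlen, smul_eq_mul]
      ring
    rw [hc, ← intervalIntegral.integral_sub (by simp) (hint _ _)]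
    refine (intervalIntegral.norm_integral_le_of_norm_le_const (C := ε / 2) fun t ht => ?_).trans
      ?_
    · rw [Set.uIoc_of_le hle] at ht
      have hg := grid_mem_Icc j
      have h1 : ((((j : ℕ) + 1 : ℕ) : ℝ) / n) = (((j : ℕ) : ℝ) + 1) / n := by push_cast; rfl
      rw [h1] at ht hlen
      have h0 : (0 : ℝ) ≤ ((j : ℕ) : ℝ) / n := by positivity
      have := hfδ _ hg t ⟨by linarith [ht.1], ht.2.trans hg.2⟩ (by
        rw [Real.dist_eq, abs_of_nonneg (by linarith [ht.2])]
        linarith [ht.1])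
      rw [Real.dist_eq] at this
      exact this.le
    · rw [hlen, abs_of_pos (by positivity)]
      exact le_of_eq (by ring)
  refine (norm_sum_le _ _).trans_lt ((Finset.sum_le_sum fun j _ => hterm j).trans_lt ?_)
  simp only [Finset.sum_const, Finset.card_univ, Fintype.card_fin, nsmul_eq_mul]
  field_simp
  linarith

/-- The asymptotic log-partition function of independent bits with logits `ψ (j / n)`. -/
noncomputable def logPart (ψ : ℝ → ℝ) : ℝ := ∫ t in (0 : ℝ)..1, softplus (ψ t)

/-- The asymptotic mean of the normalized score of independent bits with logits `ψ (j / n)`. -/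
noncomputable def meanScore (c ψ : ℝ → ℝ) : ℝ := ∫ t in (0 : ℝ)..1, c t * Real.sigmoid (ψ t)

/-- The large deviation rate of the normalized score at the value `meanScore c (φ + b c)`. -/
noncomputable def rate (φ c : ℝ → ℝ) (b : ℝ) : ℝ :=
  b * meanScore c (fun t => φ t + b * c t) - (logPart (fun t => φ t + b * c t) - logPart φ)

theorem tendsto_log_moment {φ c : ℝ → ℝ} (hφ : Continuous φ) (hc : Continuous c) (b : ℝ) :
    Tendsto (fun n : ℕ => (∑ j, (softplus (sample φ n j + b * sample c n j)
      - softplus (sample φ n j))) / n) atTop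
      (𝓝 (logPart (fun t => φ t + b * c t) - logPart φ)) := by
  have h1 : Continuous fun t => softplus (φ t + b * c t) := by fun_prop
  have h2 : Continuous fun t => softplus (φ t) := by fun_prop
  rw [logPart, logPart, ← intervalIntegral.integral_sub (h1.intervalIntegrable _ _)
    (h2.intervalIntegrable _ _)]
  exact tendsto_sum_sample_div (h1.sub h2)

theorem tendsto_meanScore {ψ c : ℝ → ℝ} (hψ : Continuous ψ) (hc : Continuous c) :
    Tendsto (fun n : ℕ => (∑ j, sample c n j * Real.sigmoid (sample ψ n j)) / n) atTop
      (𝓝 (meanScore c ψ)) :=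
  tendsto_sum_sample_div (by fun_prop : Continuous fun t => c t * Real.sigmoid (ψ t))

theorem exists_abs_sample_le {c : ℝ → ℝ} (hc : Continuous c) :
    ∃ K, 0 < K ∧ ∀ n j, |sample c n j| ≤ K := by
  obtain ⟨K, hK⟩ := (isCompact_Icc (a := (0 : ℝ)) (b := 1)).exists_bound_of_continuousOn
    hc.continuousOn
  exact ⟨max K 1, by positivity, fun n j => (hK _ (grid_mem_Icc j)).trans (le_max_left _ _)⟩

/-! ### Law of large numbers and large deviations -/

theorem tendsto_exp_nat_mul_neg {a : ℝ} (ha : 0 < a) :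
    Tendsto (fun n : ℕ => Real.exp (n * -a)) atTop (𝓝 0) := by
  refine Real.tendsto_exp_atBot.comp ?_
  exact tendsto_natCast_atTop_atTop.atTop_mul_const_of_neg (neg_neg_of_pos ha)

theorem eventually_exp_nat_mul_neg_le {a ε : ℝ} (ha : 0 < a) (hε : 0 < ε) :
    ∀ᶠ n : ℕ in atTop, Real.exp (n * -a) ≤ ε :=
  ((tendsto_exp_nat_mul_neg ha).eventually (gt_mem_nhds hε)).mono fun _ h => h.le

theorem tendsto_prob_deviation_one_sided {ψ c : ℝ → ℝ} (hψ : Continuous ψ) (hc : Continuous c)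
    {δ σ : ℝ} (hδ : 0 < δ) (hσ : |σ| = 1) :
    Tendsto (fun n : ℕ => prob (sample ψ n)
      {z | n * δ ≤ σ * (score (sample c n) z - n * meanScore c ψ)}) atTop (𝓝 0) := by
  obtain ⟨K, hK0, hK⟩ := exists_abs_sample_le hc
  -- `s * K ≤ 1` keeps the quadratic bound valid, and `s ≤ δ / (4 * K ^ 2)` makes its cost at most
  -- `s * δ / 4`. The gain is `s * δ / 2`, since half of `δ` pays for the Riemann sum error.
  set s : ℝ := min (1 / K) (δ / (4 * K ^ 2)) with hs
  have hs0 : 0 < s := by positivity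
  have hs1 : s * K ≤ 1 := by
    have := min_le_left (1 / K) (δ / (4 * K ^ 2))
    rwa [← hs, le_div_iff₀ hK0] at this
  have hs2 : (s * K) ^ 2 ≤ s * δ / 4 := by
    have := min_le_right (1 / K) (δ / (4 * K ^ 2))
    rw [← hs, le_div_iff₀ (by positivity)] at this
    nlinarith
  have hlim := (tendsto_meanScore hψ hc).eventually (Metric.ball_mem_nhds _ (half_pos hδ))
  refine squeeze_zero' (Eventually.of_forall fun n => prob_nonneg _ _) ?_
    (tendsto_exp_nat_mul_neg (a := s * δ / 4) (by positivity))
  filter_upwards [hlim, eventually_gt_atTop 0] with n hn hn0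
  have hn0' : (0 : ℝ) < n := by exact_mod_cast hn0
  have hss : |σ * s| = s := by rw [abs_mul, hσ, one_mul, abs_of_pos hs0]
  have hσ2 : σ ^ 2 = 1 := by rw [← sq_abs, hσ, one_pow]
  refine (prob_mono _ ?_).trans ((prob_deviation_le (sample ψ n) (sample c n) (K := K)
    (s := σ * s) (δ := s * δ / 2) (hK n) (by rw [hss]; exact hs1)).trans ?_)
  · intro z hz
    simp only [Set.mem_ofPred_eq] at hz ⊢
    rw [Real.dist_eq, abs_lt] at hn
    set T := ∑ i, sample c n i * Real.sigmoid (sample ψ n i)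
    have h1 : σ * (T - n * meanScore c ψ) ≤ n * (δ / 2) := by
      have : |T - n * meanScore c ψ| ≤ n * (δ / 2) := by
        have e : T = n * (T / n) := by field_simp
        rw [e, ← mul_sub, abs_mul, abs_of_pos hn0']
        exact mul_le_mul_of_nonneg_left (abs_le.2 ⟨by linarith [hn.1], by linarith [hn.2]⟩) hn0'.le
      calc _ ≤ |σ * (T - n * meanScore c ψ)| := le_abs_self _
        _ ≤ _ := by rw [abs_mul, hσ, one_mul]; exact this
    have h2 : σ * T + n * (δ / 2) ≤ σ * score (sample c n) z := by nlinarith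
    calc σ * s * T + n * (s * δ / 2) = s * (σ * T + n * (δ / 2)) := by ring
      _ ≤ s * (σ * score (sample c n) z) := mul_le_mul_of_nonneg_left h2 hs0.le
      _ = _ := by ring
  · refine Real.exp_le_exp.2 (mul_le_mul_of_nonneg_left ?_ hn0'.le)
    have : (σ * s * K) ^ 2 = (s * K) ^ 2 := by
      rw [mul_assoc, mul_pow, hσ2, one_mul]
    linarith

/-- The weak law of large numbers for the normalized score. -/
theorem tendsto_prob_deviation {ψ c : ℝ → ℝ} (hψ : Continuous ψ) (hc : Continuous c)
    {δ : ℝ} (hδ : 0 < δ) :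
    Tendsto (fun n : ℕ => prob (sample ψ n)
      {z | n * δ ≤ |score (sample c n) z - n * meanScore c ψ|}) atTop (𝓝 0) := by
  have h := (tendsto_prob_deviation_one_sided hψ hc hδ (σ := 1) (by simp)).add
    (tendsto_prob_deviation_one_sided hψ hc hδ (σ := -1) (by simp))
  rw [add_zero] at h
  refine squeeze_zero (fun n => prob_nonneg _ _) (fun n => ?_) h
  refine (prob_mono _ fun z hz => ?_).trans (prob_union_le _ _ _)
  rcases le_abs.1 (Set.mem_ofPred_eq ▸ hz) with h | h
  · left
    simpa using h
  · right
    simp only [Set.mem_ofPred_eq]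
    linarith

/-- Large deviation lower bound for the normalized score. -/
theorem eventually_le_prob_window {φ c : ℝ → ℝ} (hφ : Continuous φ) (hc : Continuous c) (b : ℝ)
    {δ η : ℝ} (hδ : 0 < δ) (hη : 0 < η) :
    ∀ᶠ n : ℕ in atTop, Real.exp (n * -(rate φ c b + |b| * δ + η)) ≤ prob (sample φ n)
      {z | |score (sample c n) z - n * meanScore c (fun t => φ t + b * c t)| < n * δ} := by
  have hψ : Continuous fun t => φ t + b * c t := by fun_prop
  set x := meanScore c (fun t => φ t + b * c t) with hx
  have h1 := (tendsto_prob_deviation hψ hc hδ).eventually (gt_mem_nhds one_half_pos)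
  have h2 := (tendsto_log_moment hφ hc b).eventually (lt_mem_nhds (sub_lt_self _ (half_pos hη)))
  filter_upwards [h1, h2, eventually_exp_nat_mul_neg_le (half_pos hη) one_half_pos,
    eventually_gt_atTop 0] with n hn1 hn2 hn3 hn0
  have hn0' : (0 : ℝ) < n := by exact_mod_cast hn0
  set A : Set (Word n) := {z | |score (sample c n) z - n * x| < n * δ} with hA
  have hc1 : {z : Word n | n * δ ≤ |score (sample c n) z - n * x|} = Aᶜ := by
    ext z
    simp [hA]
  -- The window is typical for the tilted law. Returning to the original law costs the rate, and the
  -- factor `1 / 2` is absorbed by half of `η`.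
  have hp : 1 / 2 ≤ prob (sample (fun t => φ t + b * c t) n) A := by
    rw [← hx, hc1, prob_compl] at hn1
    linarith
  have key := exp_mul_prob_le (sample φ n) (sample c n) b (n * (b * x + |b| * δ)) (A := A) (by
    intro z hz
    have h3 : b * (score (sample c n) z - n * x) ≤ |b| * (n * δ) :=
      (le_abs_self _).trans ((abs_mul _ _).trans_le
        (mul_le_mul_of_nonneg_left (le_of_lt hz) (abs_nonneg b)))
    linarith)
  refine le_trans ?_ key
  rw [lt_div_iff₀ hn0'] at hn2
  have h4 : Real.exp (n * -(rate φ c b + |b| * δ + η)) ≤ Real.exp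
      (∑ j, (softplus (sample φ n j + b * sample c n j) - softplus (sample φ n j))
        - n * (b * x + |b| * δ)) * Real.exp (n * -(η / 2)) := by
    rw [← Real.exp_add, Real.exp_le_exp, rate, ← hx]
    nlinarith
  refine h4.trans (mul_le_mul_of_nonneg_left (hn3.trans hp) (Real.exp_pos _).le)

/-- Large deviation upper bound for the normalized score. -/
theorem eventually_prob_le {φ c : ℝ → ℝ} (hφ : Continuous φ) (hc : Continuous c) (b : ℝ)
    {η : ℝ} (hη : 0 < η) :
    ∀ᶠ n : ℕ in atTop, ∀ y : ℝ, prob (sample φ n) {z | n * (b * y) ≤ b * score (sample c n) z}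
      ≤ Real.exp (n * -(rate φ c b + b * (y - meanScore c (fun t => φ t + b * c t)) - η)) := by
  filter_upwards [(tendsto_log_moment hφ hc b).eventually (gt_mem_nhds (lt_add_of_pos_right _ hη)),
    eventually_gt_atTop 0] with n hn hn0 y
  have hn0' : (0 : ℝ) < n := by exact_mod_cast hn0
  refine (prob_le_exp_moment (sample φ n) (sample c n) b _ fun z hz => hz).trans
    (Real.exp_le_exp.2 ?_)
  rw [div_lt_iff₀ hn0'] at hn
  rw [rate]
  linarith

theorem continuous_meanScore {φ c : ℝ → ℝ} (hφ : Continuous φ) (hc : Continuous c) :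
    Continuous fun b => meanScore c (fun t => φ t + b * c t) := by
  unfold meanScore
  apply intervalIntegral.continuous_parametric_intervalIntegral_of_continuous'
  simp only [Function.uncurry_def]
  fun_prop

theorem continuous_logPart {φ c : ℝ → ℝ} (hφ : Continuous φ) (hc : Continuous c) :
    Continuous fun b => logPart (fun t => φ t + b * c t) := by
  unfold logPart
  apply intervalIntegral.continuous_parametric_intervalIntegral_of_continuous'
  simp only [Function.uncurry_def]
  fun_prop

theorem continuous_rate {φ c : ℝ → ℝ} (hφ : Continuous φ) (hc : Continuous c) :
    Continuous (rate φ c) :=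
  (continuous_id.mul (continuous_meanScore hφ hc)).sub
    ((continuous_logPart hφ hc).sub continuous_const)

/-- By continuity, positivity at the single point `1` suffices; the rank weight `c t = t` vanishes
at `0`. -/
theorem strictMono_meanScore {φ c : ℝ → ℝ} (hφ : Continuous φ) (hc : Continuous c)
    (hc0 : ∀ t ∈ Set.Icc (0 : ℝ) 1, 0 ≤ c t) (hc1 : 0 < c 1) :
    StrictMono fun b => meanScore c (fun t => φ t + b * c t) := by
  intro b b' hb
  refine intervalIntegral.integral_lt_integral_of_continuousOn_of_le_of_exists_lt zero_lt_one
    (by fun_prop) (by fun_prop) (fun t ht => ?_) ⟨1, by simp, ?_⟩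
  · have h := hc0 t ⟨ht.1.le, ht.2⟩
    exact mul_le_mul_of_nonneg_left (Real.sigmoid_le (by nlinarith)) h
  · exact mul_lt_mul_of_pos_left (Real.sigmoid_lt (by nlinarith)) hc1

/-! ### Exponential rates -/

/-- The exponential decay rate of `p n` is `e`. -/
def HasRate (p : ℕ → ℝ) (e : ℝ) : Prop :=
  ∀ η, 0 < η → ∀ᶠ n : ℕ in atTop, Real.exp (n * -(e + η)) ≤ p n ∧ p n ≤ Real.exp (n * -(e - η))

theorem HasRate.hasExponent {p : ℕ → ℝ} {e : ℝ} (h : HasRate p e) :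
    HasExponent p (e / Real.log 2) := by
  refine ⟨(h 1 one_pos).mono fun n hn => (Real.exp_pos _).trans_le hn.1, ?_⟩
  have hlog : Tendsto (fun n : ℕ => -(Real.log (p n) / n)) atTop (𝓝 e) := by
    rw [Metric.tendsto_atTop']
    intro ε hε
    obtain ⟨N, hN⟩ := eventually_atTop.1 (h (ε / 2) (half_pos hε))
    refine ⟨N, fun n hn => ?_⟩
    have hn0 : (0 : ℝ) < n := by exact_mod_cast (Nat.zero_le N).trans_lt hn
    obtain ⟨h1, h2⟩ := hN n hn.le
    have hp := (Real.exp_pos _).trans_le h1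
    have h3 := (Real.le_log_iff_exp_le hp).2 h1
    have h4 := (Real.log_le_iff_le_exp hp).2 h2
    have h5 : Real.log (p n) / n ≤ -(e - ε / 2) := by
      rw [div_le_iff₀ hn0]
      linarith
    have h6 : -(e + ε / 2) ≤ Real.log (p n) / n := by
      rw [le_div_iff₀ hn0]
      linarith
    rw [Real.dist_eq, abs_lt]
    constructor <;> linarith
  refine (hlog.div_const (Real.log 2)).congr fun n => ?_
  rw [Real.logb]
  ring

theorem eventually_exp_le_code_size {M : ℕ → ℕ} {R η : ℝ} (hM : ∀ᶠ n in atTop, 2 ≤ M n)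
    (hR : Tendsto (fun n : ℕ => Real.log (M n) / n) atTop (𝓝 R)) (hη : 0 < η) :
    ∀ᶠ n : ℕ in atTop, Real.exp (n * (R - η)) ≤ M n ∧ (M n : ℝ) ≤ Real.exp (n * (R + η)) := by
  filter_upwards [hM, hR.eventually (Metric.ball_mem_nhds R hη), eventually_gt_atTop 0]
    with n hn h hn0
  have hn0' : (0 : ℝ) < n := by exact_mod_cast hn0
  have hM0 : (0 : ℝ) < M n := by exact_mod_cast (by omega : 0 < M n)
  rw [Real.dist_eq, abs_lt] at h
  have h1 : R - η ≤ Real.log (M n) / n := by linarith [h.1]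
  have h2 : Real.log (M n) / n ≤ R + η := by linarith [h.2]
  rw [le_div_iff₀ hn0'] at h1
  rw [div_le_iff₀ hn0'] at h2
  exact ⟨(Real.le_log_iff_exp_le hM0).1 (by linarith),
    (Real.log_le_iff_le_exp hM0).1 (by linarith)⟩

theorem const_mul_prob_le_mean {n : ℕ} (ψ : Fin n → ℝ) {f : Word n → ℝ} {A : Set (Word n)} {v : ℝ}
    (hf : ∀ z, 0 ≤ f z) (hA : ∀ z ∈ A, v ≤ f z) : v * prob ψ A ≤ mean ψ f := by
  rw [prob, ← mean_const_mul]
  refine mean_mono ψ fun z => ?_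
  by_cases hz : z ∈ A
  · simpa [hz] using hA z hz
  · simpa [hz] using hf z

theorem mean_le_prob_add {n : ℕ} (ψ : Fin n → ℝ) {f : Word n → ℝ} {A : Set (Word n)} {v : ℝ}
    (hv : 0 ≤ v) (hf : ∀ z, f z ≤ 1) (hA : ∀ z ∉ A, f z ≤ v) : mean ψ f ≤ prob ψ A + v := by
  rw [prob, ← mean_const ψ v, ← mean_add]
  refine mean_mono ψ fun z => ?_
  by_cases hz : z ∈ A
  · simpa [hz] using (hf z).trans (le_add_of_nonneg_right hv)
  · simpa [hz] using hA z hz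

/-! ### Exponents of minimum score decoding -/

/-- The law of uniformly distributed words, as independent bits with logits zero. -/
noncomputable abbrev unifLogit (n : ℕ) : Fin n → ℝ := sample (fun _ => 0) n

/-- Probability that none of `M - 1` uniform guesses has a score at most that of the noise. -/
noncomputable def strictSuccess (φ c : ℝ → ℝ) (n M : ℕ) : ℝ :=
  mean (sample φ n) fun z =>
    prob (unifLogit n) {z' | score (sample c n) z < score (sample c n) z'} ^ (M - 1)

/-- Probability that none of `M - 1` uniform guesses has a score less than that of the noise. -/
noncomputable def weakSuccess (φ c : ℝ → ℝ) (n M : ℕ) : ℝ :=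
  mean (sample φ n) fun z =>
    prob (unifLogit n) {z' | score (sample c n) z ≤ score (sample c n) z'} ^ (M - 1)

theorem prob_score_lt_eq {n : ℕ} (ψ c : Fin n → ℝ) (y : ℝ) :
    prob ψ {z' | y < score c z'} = 1 - prob ψ {z' | score c z' ≤ y} := by
  rw [← prob_compl]
  congr 1
  ext z
  simp

theorem prob_score_le_eq {n : ℕ} (ψ c : Fin n → ℝ) (y : ℝ) :
    prob ψ {z' | y ≤ score c z'} = 1 - prob ψ {z' | score c z' < y} := by
  rw [← prob_compl]
  congr 1
  ext z
  simp

theorem one_sub_pow_le_exp {Q : ℝ} (hQ : Q ≤ 1) (k : ℕ) :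
    (1 - Q) ^ k ≤ Real.exp (-(k * Q)) := by
  rw [← mul_neg, Real.exp_nat_mul]
  exact pow_le_pow_left₀ (by linarith) (by linarith [Real.add_one_le_exp (-Q)]) k

theorem one_sub_mul_le_one_sub_pow {Q : ℝ} (hQ : Q ≤ 1) (k : ℕ) :
    1 - k * Q ≤ (1 - Q) ^ k := by
  have := one_add_mul_le_pow (a := -Q) (by linarith) k
  rw [← sub_eq_add_neg] at this
  linarith

/-- `1 - (1 - Q) ^ k ≥ 1 - exp (-v) ≥ v / 2` for `v ≤ 1`: the union bound is sharp up to a constant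
while it is at most one. -/
theorem half_mul_le_one_sub_pow {Q v : ℝ} (hQ1 : Q ≤ 1) (k : ℕ) (hv0 : 0 ≤ v)
    (hv1 : v ≤ 1) (hv : v ≤ k * Q) : v / 2 ≤ 1 - (1 - Q) ^ k := by
  have h1 := one_sub_pow_le_exp hQ1 k
  have h2 : Real.exp (-(k * Q)) ≤ Real.exp (-v) := Real.exp_le_exp.2 (by linarith)
  have h3 : Real.exp (-v) ≤ 1 - v / 2 := by
    rw [Real.exp_neg]
    refine inv_le_of_inv_le₀ (by linarith) (le_trans ?_ (Real.add_one_le_exp v))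
    rw [inv_le_iff_one_le_mul₀ (by linarith)]
    nlinarith
  linarith

/-- Gallager's device: a union bound capped at `1` is at most its own `ρ`-th power. -/
theorem one_sub_pow_le_exp_mul {Q w ρ : ℝ} (hQ1 : Q ≤ 1) (k : ℕ)
    (hρ0 : 0 ≤ ρ) (hρ1 : ρ ≤ 1) (hw : k * Q ≤ Real.exp w) :
    1 - (1 - Q) ^ k ≤ Real.exp (ρ * w) := by
  rcases le_or_gt 0 w with h | h
  · have h1 : (0 : ℝ) ≤ (1 - Q) ^ k := pow_nonneg (by linarith) k
    have h2 := Real.one_le_exp (mul_nonneg hρ0 h)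
    linarith
  · have h1 := one_sub_mul_le_one_sub_pow hQ1 k
    have h2 : Real.exp w ≤ Real.exp (ρ * w) := Real.exp_le_exp.2 (by nlinarith)
    linarith

/-- Gallager's bound on the error probability. -/
theorem eventually_one_sub_strictSuccess_le {φ c : ℝ → ℝ} (hφ : Continuous φ) (hc : Continuous c)
    {a θ ρ R : ℝ} (hρ0 : 0 ≤ ρ) (hρ1 : ρ ≤ 1) (ha : a = ρ * θ) (hθ : 0 < θ)
    (hx : meanScore c (fun t => φ t + a * c t) = meanScore c (fun t => 0 + -θ * c t))
    {M : ℕ → ℕ} (hM : ∀ᶠ n in atTop, 2 ≤ M n)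
    (hR : Tendsto (fun n : ℕ => Real.log (M n) / n) atTop (𝓝 R)) {η : ℝ} (hη : 0 < η) :
    ∀ᶠ n : ℕ in atTop, 1 - strictSuccess φ c n (M n)
      ≤ Real.exp (n * -(rate φ c a + ρ * (rate (fun _ => 0) c (-θ) - R) - η)) := by
  have h0 : Continuous fun _ : ℝ => (0 : ℝ) := continuous_const
  have hlim := (tendsto_log_moment hφ hc a).add
    ((hR.add (tendsto_log_moment h0 hc (-θ))).const_mul ρ)
  filter_upwards [hM, hlim.eventually (gt_mem_nhds (lt_add_of_pos_right _ hη)),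
    eventually_gt_atTop 0] with n hn h hn0
  have hn0' : (0 : ℝ) < n := by exact_mod_cast hn0
  have hM0 : (0 : ℝ) < M n := by exact_mod_cast (by omega : 0 < M n)
  set A := ∑ j, (softplus (sample φ n j + a * sample c n j) - softplus (sample φ n j)) with hA
  set B := ∑ j, (softplus (sample (fun _ => 0) n j + -θ * sample c n j)
    - softplus (sample (fun _ => 0) n j)) with hB
  have hpt : ∀ z : Word n,
      1 - prob (unifLogit n) {z' | score (sample c n) z < score (sample c n) z'} ^ (M n - 1)
        ≤ Real.exp (ρ * (Real.log (M n) + B)) * Real.exp (a * score (sample c n) z) := by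
    intro z
    rw [prob_score_lt_eq, ← Real.exp_add]
    have h1 := prob_le_exp_moment (unifLogit n) (sample c n) (-θ) (-θ * score (sample c n) z)
      (A := {z' | score (sample c n) z' ≤ score (sample c n) z})
    have h2 : prob (unifLogit n) {z' | score (sample c n) z' ≤ score (sample c n) z}
        ≤ Real.exp (B + θ * score (sample c n) z) := by
      refine (h1 fun z' hz' => ?_).trans_eq ?_
      · have : score (sample c n) z' ≤ score (sample c n) z := hz'
        nlinarith
      · rw [hB]
        congr 1
        ring
    refine (one_sub_pow_le_exp_mul (prob_le_one _ _) (M n - 1) hρ0 hρ1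
      (w := Real.log (M n) + (B + θ * score (sample c n) z)) ?_).trans_eq ?_
    · rw [Real.exp_add, Real.exp_log hM0]
      refine mul_le_mul ?_ h2 (prob_nonneg _ _) hM0.le
      exact_mod_cast Nat.sub_le _ _
    · rw [ha]
      congr 1
      ring
  have h3 : 1 - strictSuccess φ c n (M n)
      ≤ Real.exp (ρ * (Real.log (M n) + B)) * Real.exp A := by
    rw [hA, ← mean_exp_score, ← mean_const_mul, strictSuccess, ← mean_const (sample φ n) 1,
      ← mean_sub]
    exact mean_mono _ hpt
  refine h3.trans ?_
  rw [← Real.exp_add, Real.exp_le_exp]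
  have h4 : ρ * (Real.log (M n) + B) + A
      = n * (A / n + ρ * (Real.log (M n) / n + B / n)) := by
    field_simp
    ring
  rw [h4]
  refine mul_le_mul_of_nonneg_left (h.le.trans_eq ?_) hn0'.le
  -- At the common mean score `x`, the linear terms `a x` and `-ρ θ x` of the two rates cancel,
  -- leaving the log-moments.
  rw [rate, rate, ← hx, ha]
  ring

theorem exists_pos_mul_le (K : ℝ) {d η : ℝ} (hd : 0 < d) (hη : 0 < η) :
    ∃ δ, 0 < δ ∧ δ ≤ d ∧ |K| * δ ≤ η := by
  have hK : 0 < |K| + 1 := by positivity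
  refine ⟨min d (η / (|K| + 1)), by positivity, min_le_left _ _, ?_⟩
  have h1 := min_le_right d (η / (|K| + 1))
  rw [le_div_iff₀ hK] at h1
  have h2 : 0 < min d (η / (|K| + 1)) := by positivity
  linarith

/-- One way to fail: the noise scores near `n x`, at cost `rate φ c a`, and some guess scores below
it, with probability about `M` times that for a single guess. As `R` is at most the guess rate, this
union bound is not saturated. -/
theorem eventually_le_one_sub_weakSuccess {φ c : ℝ → ℝ} (hφ : Continuous φ) (hc : Continuous c)
    (hc0 : ∀ t ∈ Set.Icc (0 : ℝ) 1, 0 ≤ c t) (hc1 : 0 < c 1) {a θ R : ℝ}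
    (hx : meanScore c (fun t => φ t + a * c t) = meanScore c (fun t => 0 + -θ * c t))
    (hRθ : R ≤ rate (fun _ => 0) c (-θ))
    {M : ℕ → ℕ} (hM : ∀ᶠ n in atTop, 2 ≤ M n)
    (hR : Tendsto (fun n : ℕ => Real.log (M n) / n) atTop (𝓝 R)) {η : ℝ} (hη : 0 < η) :
    ∀ᶠ n : ℕ in atTop,
      Real.exp (n * -(rate φ c a + (rate (fun _ => 0) c (-θ) - R) + 8 * η))
        ≤ 1 - weakSuccess φ c n (M n) := by
  have h0 : Continuous fun _ : ℝ => (0 : ℝ) := continuous_const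
  have hcont : Continuous fun θ => rate (fun _ => 0) c (-θ) := (continuous_rate h0 hc).comp
    continuous_neg
  -- A slightly stronger tilt centres the guesses at `x' < x`, so that narrow windows around `n x'`
  -- and `n x` are separated and the guess beats the noise strictly.
  obtain ⟨θ', hθ', hθη⟩ : ∃ θ', θ < θ' ∧
      rate (fun _ => 0) c (-θ') < rate (fun _ => 0) c (-θ) + η := by
    have h1 := (hcont.tendsto θ).eventually (gt_mem_nhds (lt_add_of_pos_right _ hη))
    exact ((h1.filter_mono nhdsWithin_le_nhds).and (self_mem_nhdsWithin (s := Set.Ioi θ))).exists.imp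
      fun _ h => ⟨h.2, h.1⟩
  set x := meanScore c (fun t => φ t + a * c t) with hxdef
  set x' := meanScore c (fun t => 0 + -θ' * c t) with hx'def
  have hxx : x' < x := by
    rw [hx]
    exact strictMono_meanScore h0 hc hc0 hc1 (neg_lt_neg hθ')
  obtain ⟨δ₁, hδ₁, hδx, hδa⟩ := exists_pos_mul_le a (half_pos (sub_pos.2 hxx)) hη
  obtain ⟨δ, hδ, hδ1, hδθ⟩ := exists_pos_mul_le (-θ') hδ₁ hη
  filter_upwards [hM, eventually_exp_le_code_size hM hR hη,
    eventually_le_prob_window hφ hc a hδ₁ hη, eventually_le_prob_window h0 hc (-θ') hδ hη,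
    eventually_exp_nat_mul_neg_le hη one_half_pos] with n hn2 hnM hw1 hw2 hhalf
  have hn0' : (0 : ℝ) ≤ n := Nat.cast_nonneg n
  -- Of the `5 * η`, three come from the guess probability (change of tilt, window width, deviation
  -- bound) and two from `M - 1 ≥ exp (n (R - 2 η))`.
  set v := Real.exp (n * -(rate (fun _ => 0) c (-θ) - R + 5 * η)) with hv
  have hv1 : v ≤ 1 := by
    rw [hv, Real.exp_le_one_iff]
    nlinarith
  have hpt : ∀ z : Word n, |score (sample c n) z - n * x| < n * δ₁ → v / 2 ≤
      1 - prob (unifLogit n) {z' | score (sample c n) z ≤ score (sample c n) z'} ^ (M n - 1) := by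
    intro z hz
    rw [prob_score_le_eq]
    refine half_mul_le_one_sub_pow (prob_le_one _ _) _ (Real.exp_pos _).le hv1 ?_
    have h1 : Real.exp (n * -(rate (fun _ => 0) c (-θ) + 3 * η))
        ≤ prob (unifLogit n) {z' | score (sample c n) z' < score (sample c n) z} := by
      refine le_trans (Real.exp_le_exp.2 ?_) (hw2.trans (prob_mono _ fun z' hz' => ?_))
      · exact mul_le_mul_of_nonneg_left (by linarith) hn0'
      · have h3 := (abs_lt.1 hz).1
        have h4 := (abs_lt.1 (show |score (sample c n) z' - n * x'| < n * δ from hz')).2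
        have h5 : (n : ℝ) * (x' + δ + δ₁) ≤ n * x :=
          mul_le_mul_of_nonneg_left (by linarith) hn0'
        show score (sample c n) z' < score (sample c n) z
        linarith
    have h2 : (M n : ℝ) / 2 ≤ ((M n - 1 : ℕ) : ℝ) := by
      rw [Nat.cast_sub (by omega)]
      have : (2 : ℝ) ≤ M n := by exact_mod_cast hn2
      push_cast
      linarith
    have h3 : Real.exp (n * -η) * Real.exp (n * (R - η)) ≤ ((M n - 1 : ℕ) : ℝ) := by
      refine (mul_le_mul hhalf hnM.1 (Real.exp_pos _).le one_half_pos.le).trans ?_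
      linarith
    refine le_trans (le_of_eq ?_) (mul_le_mul h3 h1 (Real.exp_pos _).le (Nat.cast_nonneg _))
    rw [hv, ← Real.exp_add, ← Real.exp_add]
    congr 1
    ring
  have hmain : v / 2 * prob (sample φ n) {z | |score (sample c n) z - n * x| < n * δ₁}
      ≤ 1 - weakSuccess φ c n (M n) := by
    rw [weakSuccess, ← mean_const (sample φ n) 1, ← mean_sub]
    refine const_mul_prob_le_mean _ (fun z => ?_) fun z hz => hpt z hz
    exact sub_nonneg.2 (pow_le_one₀ (prob_nonneg _ _) (prob_le_one _ _))
  refine le_trans ?_ hmain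
  have h6 : Real.exp (n * -η) * v * Real.exp (n * -(rate φ c a + |a| * δ₁ + η)) ≤
      v / 2 * prob (sample φ n) {z | |score (sample c n) z - n * x| < n * δ₁} := by
    refine mul_le_mul ?_ hw1 (Real.exp_pos _).le (by positivity)
    have : 0 < v := Real.exp_pos _
    nlinarith
  refine le_trans ?_ h6
  rw [hv, ← Real.exp_add, ← Real.exp_add, Real.exp_le_exp]
  have : (n : ℝ) * (|a| * δ₁) ≤ n * η := mul_le_mul_of_nonneg_left hδa hn0'
  linarith

/-- The error exponent of minimum score decoding of random codes. -/
theorem hasRate_error {φ c : ℝ → ℝ} (hφ : Continuous φ) (hc : Continuous c)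
    (hc0 : ∀ t ∈ Set.Icc (0 : ℝ) 1, 0 ≤ c t) (hc1 : 0 < c 1) {a θ ρ R : ℝ}
    (hρ0 : 0 ≤ ρ) (hρ1 : ρ ≤ 1) (ha : a = ρ * θ) (hθ : 0 < θ)
    (hx : meanScore c (fun t => φ t + a * c t) = meanScore c (fun t => 0 + -θ * c t))
    (hRθ : rate (fun _ => 0) c (-θ) = R ∨ ρ = 1 ∧ R ≤ rate (fun _ => 0) c (-θ))
    {M : ℕ → ℕ} (hM : ∀ᶠ n in atTop, 2 ≤ M n)
    (hR : Tendsto (fun n : ℕ => Real.log (M n) / n) atTop (𝓝 R)) {p : ℕ → ℝ}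
    (hp1 : ∀ n, 1 - weakSuccess φ c n (M n) ≤ p n)
    (hp2 : ∀ n, p n ≤ 1 - strictSuccess φ c n (M n)) :
    HasRate p (rate φ c a + ρ * (rate (fun _ => 0) c (-θ) - R)) := by
  intro η hη
  have hle : R ≤ rate (fun _ => 0) c (-θ) := by
    rcases hRθ with h | h
    · exact h.ge
    · exact h.2
  -- Where the bracket vanishes or `ρ = 1`, Gallager's exponent with `ρ` agrees with the lower-bound
  -- exponent, which has no `ρ`.
  have heq : ρ * (rate (fun _ => 0) c (-θ) - R) = rate (fun _ => 0) c (-θ) - R := by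
    rcases hRθ with h | h
    · rw [h]
      ring
    · rw [h.1, one_mul]
  filter_upwards [eventually_le_one_sub_weakSuccess hφ hc hc0 hc1 hx hle hM hR
    (show 0 < η / 8 by positivity),
    eventually_one_sub_strictSuccess_le hφ hc hρ0 hρ1 ha hθ hx hM hR hη] with n h1 h2
  refine ⟨le_trans (le_of_eq ?_) (h1.trans (hp1 n)), (hp2 n).trans h2⟩
  rw [heq]
  congr 1
  ring

/-- Noise scoring above `n (x + δ)` meets exponentially many lighter guesses, so its success
probability is doubly exponentially small. What remains is the Chernoff bound for light noise. -/
theorem eventually_weakSuccess_le {φ c : ℝ → ℝ} (hφ : Continuous φ) (hc : Continuous c)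
    {a θ R : ℝ} (ha : a ≤ 0) (hθ : 0 < θ)
    (hx : meanScore c (fun t => φ t + a * c t) = meanScore c (fun t => 0 + -θ * c t))
    (hlt : ∀ θ', 0 < θ' → θ' < θ → rate (fun _ => 0) c (-θ') < R)
    {M : ℕ → ℕ} (hM : ∀ᶠ n in atTop, 2 ≤ M n)
    (hR : Tendsto (fun n : ℕ => Real.log (M n) / n) atTop (𝓝 R)) {η : ℝ} (hη : 0 < η) :
    ∀ᶠ n : ℕ in atTop, weakSuccess φ c n (M n) ≤ Real.exp (n * -(rate φ c a - 3 * η)) := by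
  have h0 : Continuous fun _ : ℝ => (0 : ℝ) := continuous_const
  have hcont : Continuous fun θ => meanScore c (fun t => 0 + -θ * c t) :=
    (continuous_meanScore h0 hc).comp continuous_neg
  set x := meanScore c (fun t => φ t + a * c t) with hxdef
  obtain ⟨δ, hδ, -, hδa⟩ := exists_pos_mul_le a one_pos hη
  obtain ⟨θ', ⟨hθ0, hθ'⟩, hθx⟩ : ∃ θ', (0 < θ' ∧ θ' < θ) ∧
      meanScore c (fun t => 0 + -θ' * c t) < x + δ := by
    have h1 := (hcont.tendsto θ).eventually (gt_mem_nhds (lt_add_of_pos_right _ hδ))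
    have h2 := (lt_mem_nhds hθ).filter_mono (nhdsWithin_le_nhds (s := Set.Iio θ))
    rw [hx]
    exact (((h1.filter_mono nhdsWithin_le_nhds).and h2).and
      (self_mem_nhdsWithin (s := Set.Iio θ))).exists.imp fun _ h => ⟨⟨h.1.2, h.2⟩, h.1.1⟩
  set x' := meanScore c (fun t => 0 + -θ' * c t) with hx'def
  set κ := (R - rate (fun _ => 0) c (-θ')) / 5 with hκ
  have hκ0 : 0 < κ := div_pos (sub_pos.2 (hlt θ' hθ0 hθ')) (by norm_num)
  obtain ⟨δ', hδ', hδ'x, hδ'θ⟩ := exists_pos_mul_le (-θ') (sub_pos.2 hθx) hκ0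
  -- The bound `exp (-exp (n κ))` for heavy noise need only beat `exp (-n * rate φ c a)`.
  have hgrow : ∀ᶠ n : ℕ in atTop, n * (rate φ c a) ≤ Real.exp (n * κ) := by
    have h1 : Tendsto (fun n : ℕ => (n : ℝ) * (κ ^ 2 / 2)) atTop atTop :=
      tendsto_natCast_atTop_atTop.atTop_mul_const (by positivity)
    filter_upwards [h1.eventually_ge_atTop (rate φ c a)] with n hn
    have h2 := Real.quadratic_le_exp_of_nonneg (show 0 ≤ (n : ℝ) * κ by positivity)
    have h3 : (0 : ℝ) ≤ n * κ := by positivity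
    nlinarith [mul_le_mul_of_nonneg_left hn (Nat.cast_nonneg (α := ℝ) n)]
  filter_upwards [hM, eventually_exp_le_code_size hM hR hκ0,
    eventually_prob_le hφ hc a hη, eventually_le_prob_window h0 hc (-θ') hδ' hκ0,
    eventually_exp_nat_mul_neg_le hκ0 one_half_pos, eventually_exp_nat_mul_neg_le hη one_half_pos,
    hgrow] with n hn2 hnM hch hw hhalf hhalf' hgr
  have hn0' : (0 : ℝ) ≤ n := Nat.cast_nonneg n
  set A : Set (Word n) := {z | score (sample c n) z ≤ n * (x + δ)} with hA
  have hpA : prob (sample φ n) A ≤ Real.exp (n * -(rate φ c a - 2 * η)) := by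
    refine (prob_mono _ fun z hz => ?_).trans ((hch (x + δ)).trans (Real.exp_le_exp.2 ?_))
    · show (n : ℝ) * (a * (x + δ)) ≤ a * score (sample c n) z
      have : score (sample c n) z ≤ n * (x + δ) := hz
      nlinarith
    · rw [← hxdef]
      rw [abs_of_nonpos ha] at hδa
      exact mul_le_mul_of_nonneg_left (by linarith) hn0'
  have hpt : ∀ z ∉ A,
      prob (unifLogit n) {z' | score (sample c n) z ≤ score (sample c n) z'} ^ (M n - 1)
        ≤ Real.exp (n * -(rate φ c a)) := by
    intro z hz
    have hz' : n * (x + δ) < score (sample c n) z := not_le.1 hz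
    rw [prob_score_le_eq]
    refine (one_sub_pow_le_exp (prob_le_one _ _) _).trans (Real.exp_le_exp.2 ?_)
    rw [mul_neg, neg_le_neg_iff]
    refine hgr.trans ?_
    have h1 : Real.exp (n * -(R - 3 * κ))
        ≤ prob (unifLogit n) {z' | score (sample c n) z' < score (sample c n) z} := by
      refine le_trans (Real.exp_le_exp.2 ?_) (hw.trans (prob_mono _ fun z' hz' => ?_))
      · exact mul_le_mul_of_nonneg_left (by linarith) hn0'
      · have h4 := (abs_lt.1 (show |score (sample c n) z' - n * x'| < n * δ' from hz')).2
        have h5 : (n : ℝ) * (x' + δ') ≤ n * (x + δ) :=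
          mul_le_mul_of_nonneg_left (by linarith) hn0'
        show score (sample c n) z' < score (sample c n) z
        linarith
    have h2 : (M n : ℝ) / 2 ≤ ((M n - 1 : ℕ) : ℝ) := by
      rw [Nat.cast_sub (by omega)]
      have : (2 : ℝ) ≤ M n := by exact_mod_cast hn2
      push_cast
      linarith
    have h3 : Real.exp (n * -κ) * Real.exp (n * (R - κ)) ≤ ((M n - 1 : ℕ) : ℝ) := by
      refine (mul_le_mul hhalf hnM.1 (Real.exp_pos _).le one_half_pos.le).trans ?_
      linarith
    refine le_trans (le_of_eq ?_) (mul_le_mul h3 h1 (Real.exp_pos _).le (Nat.cast_nonneg _))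
    rw [← Real.exp_add, ← Real.exp_add]
    congr 1
    ring
  have hmain := mean_le_prob_add (sample φ n) (A := A) (Real.exp_pos _).le
    (fun z => pow_le_one₀ (prob_nonneg _ _) (prob_le_one _ _)) hpt
  refine hmain.trans ?_
  have h7 : Real.exp (n * -(rate φ c a)) ≤ Real.exp (n * -(rate φ c a - 2 * η)) :=
    Real.exp_le_exp.2 (mul_le_mul_of_nonneg_left (by linarith) hn0')
  have h8 : Real.exp (n * -(rate φ c a - 2 * η))
      = Real.exp (n * -(rate φ c a - 3 * η)) * Real.exp (n * -η) := by
    rw [← Real.exp_add]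
    congr 1
    ring
  have h9 := mul_le_mul_of_nonneg_left hhalf' (Real.exp_pos (n * -(rate φ c a - 3 * η))).le
  linarith

/-- Noise tilted slightly beyond `a` is so light that the expected number of guesses at or below it
is at most `1 / 2`; success then has conditional probability at least `1 / 2`. -/
theorem eventually_le_strictSuccess {φ c : ℝ → ℝ} (hφ : Continuous φ) (hc : Continuous c)
    (hc0 : ∀ t ∈ Set.Icc (0 : ℝ) 1, 0 ≤ c t) (hc1 : 0 < c 1) {a θ R : ℝ} (hθ : 0 < θ)
    (hx : meanScore c (fun t => φ t + a * c t) = meanScore c (fun t => 0 + -θ * c t))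
    (hRθ : rate (fun _ => 0) c (-θ) = R)
    {M : ℕ → ℕ} (hM : ∀ᶠ n in atTop, 2 ≤ M n)
    (hR : Tendsto (fun n : ℕ => Real.log (M n) / n) atTop (𝓝 R)) {η : ℝ} (hη : 0 < η) :
    ∀ᶠ n : ℕ in atTop, Real.exp (n * -(rate φ c a + 4 * η)) ≤ strictSuccess φ c n (M n) := by
  have h0 : Continuous fun _ : ℝ => (0 : ℝ) := continuous_const
  obtain ⟨a', ha', haη⟩ : ∃ a', a' < a ∧ rate φ c a' < rate φ c a + η := by
    have h1 := ((continuous_rate hφ hc).tendsto a).eventually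
      (gt_mem_nhds (lt_add_of_pos_right _ hη))
    exact ((h1.filter_mono nhdsWithin_le_nhds).and (self_mem_nhdsWithin (s := Set.Iio a))).exists.imp
      fun _ h => ⟨h.2, h.1⟩
  set x := meanScore c (fun t => φ t + a * c t) with hxdef
  set x' := meanScore c (fun t => φ t + a' * c t) with hx'def
  have hxx : x' < x := strictMono_meanScore hφ hc hc0 hc1 ha'
  obtain ⟨δ, hδ, hδx, hδa⟩ := exists_pos_mul_le a' (half_pos (sub_pos.2 hxx)) hη
  -- Lowering the score by `δ` gains `3 κ` in the guess exponent. One `κ` pays for the Chernoff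
  -- slack, one for the code size, and one is left for decay.
  set κ := θ * δ / 3 with hκ
  have hκ0 : 0 < κ := by positivity
  filter_upwards [eventually_exp_le_code_size hM hR hκ0,
    eventually_prob_le h0 hc (-θ) hκ0, eventually_le_prob_window hφ hc a' hδ hη,
    eventually_exp_nat_mul_neg_le hκ0 one_half_pos, eventually_exp_nat_mul_neg_le hη one_half_pos]
    with n hnM hch hw hhalf hhalf'
  have hn0' : (0 : ℝ) ≤ n := Nat.cast_nonneg n
  have hpt : ∀ z : Word n, |score (sample c n) z - n * x'| < n * δ → 1 / 2 ≤
      prob (unifLogit n) {z' | score (sample c n) z < score (sample c n) z'} ^ (M n - 1) := by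
    intro z hz
    rw [prob_score_lt_eq]
    refine le_trans ?_ (one_sub_mul_le_one_sub_pow (prob_le_one _ _) _)
    have h1 : prob (unifLogit n) {z' | score (sample c n) z' ≤ score (sample c n) z}
        ≤ Real.exp (n * -(R + 2 * κ)) := by
      refine (prob_mono _ fun z' hz' => ?_).trans ((hch (x - δ)).trans (Real.exp_le_exp.2 ?_))
      · show (n : ℝ) * (-θ * (x - δ)) ≤ -θ * score (sample c n) z'
        have h3 : score (sample c n) z' ≤ score (sample c n) z := hz'
        have h4 := (abs_lt.1 hz).2
        have h5 : (n : ℝ) * (x' + δ + δ) ≤ n * x :=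
          mul_le_mul_of_nonneg_left (by linarith) hn0'
        nlinarith
      · rw [← hx, hRθ]
        refine mul_le_mul_of_nonneg_left ?_ hn0'
        rw [hκ]
        linarith
    have h2 : ((M n - 1 : ℕ) : ℝ) ≤ Real.exp (n * (R + κ)) :=
      le_trans (by exact_mod_cast Nat.sub_le _ _) hnM.2
    have h3 := mul_le_mul h2 h1 (prob_nonneg _ _) (Real.exp_pos _).le
    rw [← Real.exp_add] at h3
    have h4 : n * (R + κ) + n * -(R + 2 * κ) = n * -κ := by ring
    rw [h4] at h3
    linarith
  have hmain := const_mul_prob_le_mean (sample φ n) (fun z => pow_nonneg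
    (prob_nonneg (unifLogit n) {z' | score (sample c n) z < score (sample c n) z'}) (M n - 1)) hpt
  refine le_trans ?_ hmain
  refine le_trans ?_ (mul_le_mul hhalf' hw (Real.exp_pos _).le one_half_pos.le)
  rw [← Real.exp_add, Real.exp_le_exp, ← mul_add]
  exact mul_le_mul_of_nonneg_left (by linarith) hn0'

/-- The success exponent of minimum score decoding of random codes. -/
theorem hasRate_success {φ c : ℝ → ℝ} (hφ : Continuous φ) (hc : Continuous c)
    (hc0 : ∀ t ∈ Set.Icc (0 : ℝ) 1, 0 ≤ c t) (hc1 : 0 < c 1) {a θ R : ℝ}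
    (ha : a ≤ 0) (hθ : 0 < θ)
    (hx : meanScore c (fun t => φ t + a * c t) = meanScore c (fun t => 0 + -θ * c t))
    (hRθ : rate (fun _ => 0) c (-θ) = R)
    (hlt : ∀ θ', 0 < θ' → θ' < θ → rate (fun _ => 0) c (-θ') < rate (fun _ => 0) c (-θ))
    {M : ℕ → ℕ} (hM : ∀ᶠ n in atTop, 2 ≤ M n)
    (hR : Tendsto (fun n : ℕ => Real.log (M n) / n) atTop (𝓝 R)) {p : ℕ → ℝ}
    (hp1 : ∀ n, strictSuccess φ c n (M n) ≤ p n)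
    (hp2 : ∀ n, p n ≤ weakSuccess φ c n (M n)) :
    HasRate p (rate φ c a) := by
  intro η hη
  rw [hRθ] at hlt
  filter_upwards [eventually_le_strictSuccess hφ hc hc0 hc1 hθ hx hRθ hM hR
    (show 0 < η / 4 by positivity),
    eventually_weakSuccess_le hφ hc ha hθ hx hlt hM hR
    (show 0 < η / 3 by positivity)] with n h1 h2
  refine ⟨le_trans (le_of_eq ?_) (h1.trans (hp1 n)), ((hp2 n).trans h2).trans_eq ?_⟩
  · congr 1
    ring
  · congr 1
    ring

/-! ### Random codes as independent uniform guesses -/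

-- The word `C m` is free, whence the factor `2 ^ n`; each of the others ranges over `B`.
open Classical in
theorem card_forall_ne_mem {M n : ℕ} (m : Fin M) (B : Set (Word n)) :
    (∑ C : Codebook M n, if ∀ m', m' ≠ m → C m' ∈ B then (1 : ℝ) else 0)
      = 2 ^ n * (Finset.univ.filter (· ∈ B)).card ^ (M - 1) := by
  have h1 : ∀ C : Codebook M n, (if ∀ m', m' ≠ m → C m' ∈ B then (1 : ℝ) else 0)
      = ∏ m', if m' ≠ m → C m' ∈ B then (1 : ℝ) else 0 := by
    intro C
    rw [Finset.prod_ite_zero]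
    simp
  simp only [h1]
  have h2 := Finset.prod_univ_sum (fun _ : Fin M => (Finset.univ : Finset (Word n)))
    (fun m' w => if m' ≠ m → w ∈ B then (1 : ℝ) else 0)
  rw [Fintype.piFinset_univ] at h2
  rw [← h2, ← Finset.mul_prod_erase _ _ (Finset.mem_univ m)]
  congr 1
  · simp
  · rw [Finset.prod_congr rfl (g := fun _ => ((Finset.univ.filter (· ∈ B)).card : ℝ))]
    · simp
    · intro m' hm'
      simp [Finset.ne_of_mem_erase hm']

/-- Subtract all code words but the `m`-th one from the received word, if the `m`-th word is sent
and `z` is the noise. -/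
def guessFlip {M n : ℕ} (m : Fin M) (z : Word n) (C : Codebook M n) : Codebook M n :=
  fun m' => if m' = m then C m else C m + z - C m'

theorem guessFlip_involutive {M n : ℕ} (m : Fin M) (z : Word n) :
    Function.Involutive (guessFlip m z) := by
  intro C
  funext m'
  by_cases h : m' = m
  · simp [guessFlip, h]
  · simp [guessFlip, h]

theorem prob_unifLogit {n : ℕ} (B : Set (Word n)) [DecidablePred (· ∈ B)] :
    prob (unifLogit n) B = (Finset.univ.filter (· ∈ B)).card / 2 ^ n := by
  have : unifLogit n = fun _ => 0 := rfl
  simp only [prob, mean, this, gibbs_zero, ← Finset.mul_sum]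
  rw [div_eq_inv_mul]
  congr 1
  simp [Set.indicator_apply]

-- For fixed noise, `guessFlip` is a bijection of codebooks, so the competing noises `C m + z - C
-- m'` are uniform and independent like the words `C m'`.
open Classical in
theorem expect_forall_guess_mem {M n : ℕ} (m : Fin M) (z : Word n) (B : Set (Word n)) :
    (𝔼 C : Codebook M n, if ∀ m', m' ≠ m → C m + z - C m' ∈ B then (1 : ℝ) else 0)
      = prob (unifLogit n) B ^ (M - 1) := by
  have h1 : (∑ C : Codebook M n, if ∀ m', m' ≠ m → C m + z - C m' ∈ B then (1 : ℝ) else 0)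
      = ∑ C : Codebook M n, if ∀ m', m' ≠ m → C m' ∈ B then (1 : ℝ) else 0 := by
    refine Fintype.sum_equiv (guessFlip_involutive m z).toPerm _ _ fun C => ?_
    congr 1
    refine propext (forall_congr' fun m' => imp_congr_right fun h => ?_)
    simp [guessFlip, h]
  have hM : M = (M - 1) + 1 := by have := m.2; omega
  rw [Fintype.expect_eq_sum_div_card, h1, card_forall_ne_mem, prob_unifLogit, div_pow]
  have hcard : (Fintype.card (Codebook M n) : ℝ) = 2 ^ n * (2 ^ n) ^ (M - 1) := by
    rw [← pow_succ', ← hM]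
    simp [ZMod.card]
  rw [hcard, mul_div_mul_left _ _ (by positivity)]

/-- Probability of correct decoding of random codes for additive noise with law `p`. -/
noncomputable def additiveSuccess {M n : ℕ} (p : Word n → ℝ)
    (D : Codebook M n → Word n → Word n) : ℝ :=
  𝔼 C : Codebook M n, 𝔼 m : Fin M, ∑ y : Word n, if D C y = C m then p (y - C m) else 0

/-- `D` returns a code word for which the noise has the least score. -/
def IsMinScore {M n : ℕ} (S : Word n → ℝ) (D : Codebook M n → Word n → Word n) : Prop :=
  ∀ C y, D C y ∈ Set.range C ∧ ∀ m, S (y - D C y) ≤ S (y - C m)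

theorem additiveSuccess_eq {M n : ℕ} (p : Word n → ℝ) (D : Codebook M n → Word n → Word n) :
    additiveSuccess p D = 𝔼 m : Fin M, ∑ z : Word n,
      p z * 𝔼 C : Codebook M n, if D C (C m + z) = C m then (1 : ℝ) else 0 := by
  have h1 : ∀ (C : Codebook M n) (m : Fin M),
      (∑ y : Word n, if D C y = C m then p (y - C m) else 0)
        = ∑ z : Word n, p z * if D C (C m + z) = C m then (1 : ℝ) else 0 := by
    intro C m
    refine (Fintype.sum_equiv (Equiv.addLeft (C m)) _ _ fun z => ?_).symm
    simp
  simp only [additiveSuccess, h1]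
  rw [Finset.expect_comm]
  refine Finset.expect_congr rfl fun m _ => ?_
  simp only [Finset.mul_expect]
  exact Finset.expect_sum_comm _ _ _

/-- The sent word is the only minimizer when all other guesses score strictly higher, and is no
minimizer when one scores strictly lower. Ties, repeated code words included, lie in between. -/
theorem additiveSuccess_bounds {M n : ℕ} (hM : 1 ≤ M) {p S : Word n → ℝ} (hp : ∀ z, 0 ≤ p z)
    {D : Codebook M n → Word n → Word n} (hD : IsMinScore S D) :
    ∑ z, p z * prob (unifLogit n) {z' | S z < S z'} ^ (M - 1) ≤ additiveSuccess p D ∧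
      additiveSuccess p D ≤ ∑ z, p z * prob (unifLogit n) {z' | S z ≤ S z'} ^ (M - 1) := by
  classical
  have : Nonempty (Fin M) := ⟨⟨0, hM⟩⟩
  rw [additiveSuccess_eq]
  constructor
  · refine le_of_eq_of_le (Fintype.expect_const _).symm
      (Finset.expect_le_expect fun m _ => Finset.sum_le_sum fun z _ =>
        mul_le_mul_of_nonneg_left ?_ (hp z))
    rw [← expect_forall_guess_mem m z]
    refine Finset.expect_le_expect fun C _ => ?_
    split_ifs with h1 h2 h2
    · exact le_rfl
    · exfalso
      obtain ⟨⟨m', hm'⟩, hmin⟩ := hD C (C m + z)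
      have h3 : m' ≠ m := fun h => h2 (by rw [← hm', h])
      have h4 : S z < S (C m + z - C m') := h1 m' h3
      have h5 := hmin m
      rw [← hm', add_sub_cancel_left] at h5
      exact absurd h5 (not_le.2 h4)
    · exact zero_le_one
    · exact le_rfl
  · refine le_of_le_of_eq ?_ (Fintype.expect_const (ι := Fin M) _)
    refine Finset.expect_le_expect fun m _ => Finset.sum_le_sum fun z _ =>
      mul_le_mul_of_nonneg_left ?_ (hp z)
    rw [← expect_forall_guess_mem m z]
    refine Finset.expect_le_expect fun C _ => ?_
    split_ifs with h1 h2 h2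
    · exact le_rfl
    · refine absurd (fun m' _ => ?_) h2
      have h5 := (hD C (C m + z)).2 m'
      rwa [h1, add_sub_cancel_left] at h5
    · exact zero_le_one
    · exact le_rfl

/-! ### The soft-decision channel -/

theorem softLaw_eq_softNoise_sub (β : ℝ) {n : ℕ} (τ : Equiv.Perm (Fin n)) (x y : Word n) :
    softLaw β τ x y = softNoise β τ (y - x) := by
  rw [← softLaw_add β τ x, add_sub_cancel]

theorem hardLaw_eq_hardNoise_sub (β : ℝ) {n : ℕ} (x y : Word n) :
    hardLaw β x y = hardNoise β (y - x) := by
  rw [← hardLaw_add β x, add_sub_cancel]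

theorem flipProb_eq_sigmoid (β : ℝ) (n : ℕ) (j : Fin n) :
    flipProb β n j = Real.sigmoid (sample (fun t => -β * t) n j) := by
  rw [sigmoid_eq_exp_div, flipProb, sample, mul_div_assoc]

/-- The soft-decision noise effect has independent bits. -/
theorem softNoise_eq_gibbs (β : ℝ) {n : ℕ} (τ : Equiv.Perm (Fin n)) (z : Word n) :
    softNoise β τ z = gibbs (sample (fun t => -β * t) n ∘ τ) z := by
  simp [gibbs_eq_prod, softNoise, softLaw, flipProb_eq_sigmoid]

theorem sum_softLaw (β : ℝ) {n : ℕ} (τ : Equiv.Perm (Fin n)) (x : Word n) :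
    ∑ y, softLaw β τ x y = 1 := by
  simp only [softLaw_eq_softNoise_sub, softNoise_eq_gibbs]
  rw [← sum_gibbs (sample (fun t => -β * t) n ∘ τ)]
  exact Fintype.sum_equiv (Equiv.subRight x) _ _ fun y => by simp

theorem successProb_eq_expect (β : ℝ) {M n : ℕ} (D : SoftDecoder M n) :
    successProb β D = 𝔼 τ : Equiv.Perm (Fin n),
      additiveSuccess (softNoise β τ) (fun C y => D C τ y) := by
  simp only [successProb, additiveSuccess, softLaw_eq_softNoise_sub]
  exact (Finset.expect_congr rfl fun C _ => Finset.expect_comm _ _ _).trans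
    (Finset.expect_comm _ _ _)

theorem errorProb_eq_one_sub (β : ℝ) {M n : ℕ} (hM : 1 ≤ M) (D : SoftDecoder M n) :
    errorProb β D = 1 - successProb β D := by
  have : Nonempty (Fin M) := ⟨⟨0, hM⟩⟩
  rw [eq_sub_iff_add_eq, errorProb, successProb]
  simp only [← Finset.expect_add_distrib, ← Finset.sum_add_distrib]
  have h : ∀ (C : Codebook M n) (m : Fin M) (τ : Equiv.Perm (Fin n)),
      (∑ y, ((if D C τ y ≠ C m then softLaw β τ (C m) y else 0)
        + if D C τ y = C m then softLaw β τ (C m) y else 0)) = 1 := by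
    intro C m τ
    rw [← sum_softLaw β τ (C m)]
    refine Finset.sum_congr rfl fun y _ => ?_
    by_cases hy : D C τ y = C m <;> simp [hy]
  simp only [h, Fintype.expect_const]

/-- Noise law and score are relabelled by the same `τ` and the uniform guess law is invariant, so
the permutation drops out. -/
theorem sum_gibbs_perm_strict {n : ℕ} (M : ℕ) (φ c : ℝ → ℝ) (τ : Equiv.Perm (Fin n)) :
    ∑ z, gibbs (sample φ n ∘ τ) z * prob (unifLogit n)
        {z' | score (sample c n ∘ τ) z < score (sample c n ∘ τ) z'} ^ (M - 1)
      = strictSuccess φ c n M := by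
  rw [strictSuccess, ← mean_comp_perm _ _ τ, mean]
  refine Finset.sum_congr rfl fun z _ => ?_
  simp only [score_comp_perm]
  exact congrArg (fun q => gibbs (sample φ n ∘ τ) z * q ^ (M - 1)) (prob_comp_perm (unifLogit n)
    {z' | score (sample c n) (z ∘ τ.symm) < score (sample c n) z'} τ)

theorem sum_gibbs_perm_weak {n : ℕ} (M : ℕ) (φ c : ℝ → ℝ) (τ : Equiv.Perm (Fin n)) :
    ∑ z, gibbs (sample φ n ∘ τ) z * prob (unifLogit n)
        {z' | score (sample c n ∘ τ) z ≤ score (sample c n ∘ τ) z'} ^ (M - 1)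
      = weakSuccess φ c n M := by
  rw [weakSuccess, ← mean_comp_perm _ _ τ, mean]
  refine Finset.sum_congr rfl fun z _ => ?_
  simp only [score_comp_perm]
  exact congrArg (fun q => gibbs (sample φ n ∘ τ) z * q ^ (M - 1)) (prob_comp_perm (unifLogit n)
    {z' | score (sample c n) (z ∘ τ.symm) ≤ score (sample c n) z'} τ)

theorem successProb_bounds {β : ℝ} {M n : ℕ} (hM : 1 ≤ M) {D : SoftDecoder M n} {c : ℝ → ℝ}
    (hD : ∀ τ : Equiv.Perm (Fin n),
      IsMinScore (score (sample c n ∘ τ)) (fun C y => D C τ y)) :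
    strictSuccess (fun t => -β * t) c n M ≤ successProb β D ∧
      successProb β D ≤ weakSuccess (fun t => -β * t) c n M := by
  rw [successProb_eq_expect]
  have h := fun τ : Equiv.Perm (Fin n) => additiveSuccess_bounds hM
    (fun z => (gibbs_pos (sample (fun t => -β * t) n ∘ τ) z).le) (hD τ)
  simp only [sum_gibbs_perm_strict, sum_gibbs_perm_weak] at h
  simp only [← funext (softNoise_eq_gibbs β _)] at h
  constructor
  · exact le_of_eq_of_le (Fintype.expect_const _).symm
      (Finset.expect_le_expect fun τ _ => (h τ).1)
  · exact le_of_le_of_eq (Finset.expect_le_expect fun τ _ => (h τ).2) (Fintype.expect_const _)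

theorem sample_neg_mul_comp (β : ℝ) {n : ℕ} (τ : Equiv.Perm (Fin n)) :
    sample (fun t => -β * t) n ∘ τ = fun i => -β * (sample (fun t => t) n ∘ τ) i := rfl

/-- Soft-decision maximum likelihood decoding minimizes the sum of the ranks of the flipped
bits. -/
theorem IsSoftML.isMinScore {β : ℝ} (hβ : 0 < β) {M n : ℕ} {D : SoftDecoder M n}
    (hD : IsSoftML β D) (τ : Equiv.Perm (Fin n)) :
    IsMinScore (score (sample (fun t => t) n ∘ τ)) (fun C y => D C τ y) := by
  refine fun C y => ⟨(hD C τ y).1, fun m => ?_⟩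
  have h := (hD C τ y).2 m
  rw [softLaw_eq_softNoise_sub, softLaw_eq_softNoise_sub, softNoise_eq_gibbs, softNoise_eq_gibbs,
    gibbs, gibbs, Real.exp_le_exp, sub_le_sub_iff_right, sample_neg_mul_comp, score_mul,
    score_mul] at h
  nlinarith

/-! ### The hard-decision channel and Hamming weight -/

/-- The positions at which a word is nonzero. -/
def support {n : ℕ} (z : Word n) : Finset (Fin n) := Finset.univ.filter fun i => z i ≠ 0

theorem mem_support {n : ℕ} {z : Word n} {i : Fin n} : i ∈ support z ↔ z i ≠ 0 := by
  simp [support]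

theorem score_one {n : ℕ} (z : Word n) :
    score (sample (fun _ => 1) n) z = (support z).card := by
  simp [score, sample, support, Finset.sum_ite]

/-- Turns a comparison of weights into an inclusion of supports, for which the likelihoods compare
permutation by permutation. -/
theorem exists_perm_support_subset {n : ℕ} {z z' : Word n}
    (h : (support z).card ≤ (support z').card) :
    ∃ σ : Equiv.Perm (Fin n), support (z ∘ σ) ⊆ support z' ∧
      (support (z ∘ σ)).card = (support z).card := by
  obtain ⟨t, ht, hcard⟩ := Finset.exists_subset_card_eq h
  let e : {i // i ∈ t} ≃ {i // i ∈ support z} := Finset.equivOfCardEq hcard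
  have he : support (z ∘ e.extendSubtype) = t := by
    ext i
    have h1 : i ∈ support (z ∘ e.extendSubtype) ↔ e.extendSubtype i ∈ support z := by
      rw [mem_support, mem_support]
      rfl
    rw [h1]
    constructor
    · intro h2
      by_contra h3
      exact e.extendSubtype_not_mem i h3 h2
    · exact e.extendSubtype_mem i
  exact ⟨e.extendSubtype, he.trans_subset ht, by rw [he, hcard]⟩

/-- The uniform average over permutations is invariant under right multiplication. -/
theorem hardNoise_comp_perm (β : ℝ) {n : ℕ} (z : Word n) (σ : Equiv.Perm (Fin n)) :
    hardNoise β (z ∘ σ) = hardNoise β z := by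
  simp only [hardNoise, hardLaw]
  refine Fintype.expect_equiv (Equiv.mulRight σ⁻¹) _ _ fun τ => ?_
  have h := gibbs_comp_perm (sample (fun t => -β * t) n ∘ τ) z σ⁻¹
  rw [show softLaw β τ 0 (z ∘ σ) = _ from softNoise_eq_gibbs β τ (z ∘ σ),
    show softLaw β _ 0 z = _ from softNoise_eq_gibbs β _ z]
  exact h.symm

theorem softNoise_le_of_support_subset {β : ℝ} (hβ : 0 < β) {n : ℕ} (τ : Equiv.Perm (Fin n))
    {z z' : Word n} (h : support z ⊆ support z') : softNoise β τ z' ≤ softNoise β τ z := by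
  have h1 : ∀ w : Word n, score (sample (fun t => t) n ∘ τ) w
      = ∑ i ∈ support w, (sample (fun t => t) n ∘ τ) i := by
    intro w
    simp [score, support, Finset.sum_filter]
  rw [softNoise_eq_gibbs, softNoise_eq_gibbs, gibbs, gibbs, Real.exp_le_exp, sub_le_sub_iff_right,
    sample_neg_mul_comp, score_mul, score_mul, h1, h1]
  have := Finset.sum_le_sum_of_subset_of_nonneg (f := sample (fun t => t) n ∘ τ) h
    fun i _ _ => (grid_mem_Icc (τ i)).1
  nlinarith

theorem softNoise_lt_of_support_ssubset {β : ℝ} (hβ : 0 < β) {n : ℕ} (τ : Equiv.Perm (Fin n))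
    {z z' : Word n} (h : support z ⊂ support z') : softNoise β τ z' < softNoise β τ z := by
  have h1 : ∀ w : Word n, score (sample (fun t => t) n ∘ τ) w
      = ∑ i ∈ support w, (sample (fun t => t) n ∘ τ) i := by
    intro w
    simp [score, support, Finset.sum_filter]
  rw [softNoise_eq_gibbs, softNoise_eq_gibbs, gibbs, gibbs, Real.exp_lt_exp, sub_lt_sub_iff_right,
    sample_neg_mul_comp, score_mul, score_mul, h1, h1]
  obtain ⟨i, hi, hi'⟩ := Finset.exists_of_ssubset h
  have := Finset.sum_lt_sum_of_subset (f := sample (fun t => t) n ∘ τ) h.1 hi hi' (by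
    have : (0 : ℝ) < n := by exact_mod_cast i.pos
    simp only [Function.comp, sample]
    positivity) fun j _ _ => (grid_mem_Icc (τ j)).1
  nlinarith

theorem hardNoise_eq_expect (β : ℝ) {n : ℕ} (z : Word n) :
    hardNoise β z = 𝔼 τ : Equiv.Perm (Fin n), softNoise β τ z := rfl

/-- The hard-decision noise effect favours words of small Hamming weight. -/
theorem hardNoise_le_of_score_le {β : ℝ} (hβ : 0 < β) {n : ℕ} {z z' : Word n}
    (h : score (sample (fun _ => 1) n) z ≤ score (sample (fun _ => 1) n) z') :
    hardNoise β z' ≤ hardNoise β z := by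
  rw [score_one, score_one, Nat.cast_le] at h
  obtain ⟨σ, hσ, -⟩ := exists_perm_support_subset h
  rw [← hardNoise_comp_perm β z σ]
  exact Finset.expect_le_expect fun τ _ => softNoise_le_of_support_subset hβ τ hσ

/-- Strictness is what forces an ML word to have least Hamming distance; the weak version would
permit other choices. -/
theorem hardNoise_lt_of_score_lt {β : ℝ} (hβ : 0 < β) {n : ℕ} {z z' : Word n}
    (h : score (sample (fun _ => 1) n) z < score (sample (fun _ => 1) n) z') :
    hardNoise β z' < hardNoise β z := by
  rw [score_one, score_one, Nat.cast_lt] at h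
  obtain ⟨σ, hσ, hcard⟩ := exists_perm_support_subset h.le
  have hss : support (z ∘ σ) ⊂ support z' :=
    Finset.ssubset_iff_subset_ne.2 ⟨hσ, fun he => by rw [he] at hcard; omega⟩
  rw [← hardNoise_comp_perm β z σ, hardNoise_eq_expect, hardNoise_eq_expect,
    Fintype.expect_eq_sum_div_card, Fintype.expect_eq_sum_div_card]
  exact div_lt_div_of_pos_right (Finset.sum_lt_sum_of_nonempty Finset.univ_nonempty
    fun τ _ => softNoise_lt_of_support_ssubset hβ τ hss)
    (by exact_mod_cast Fintype.card_pos)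

/-- Hard-decision maximum likelihood decoding minimizes the Hamming distance. -/
theorem IsHardML.isMinScore {β : ℝ} (hβ : 0 < β) {M n : ℕ} {D : HardDecoder M n}
    (hD : IsHardML β D) (τ : Equiv.Perm (Fin n)) :
    IsMinScore (score (sample (fun _ => 1) n ∘ τ)) (fun C y => D.toSoft C τ y) := by
  refine fun C y => ⟨(hD C y).1, fun m => ?_⟩
  have h := (hD C y).2 m
  rw [hardLaw_eq_hardNoise_sub, hardLaw_eq_hardNoise_sub] at h
  by_contra hlt
  exact absurd h (not_le.2 (hardNoise_lt_of_score_lt hβ (not_le.1 hlt)))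

/-! ### Capacities -/

theorem logPart_zero : logPart (fun _ => 0) = Real.log 2 := by
  simp [logPart, softplus_zero]

theorem sum_negMulLog_gibbs {n : ℕ} (ψ : Fin n → ℝ) :
    ∑ z, Real.negMulLog (gibbs ψ z) = ∑ i, (softplus (ψ i) - ψ i * Real.sigmoid (ψ i)) := by
  have h1 : ∀ z, Real.negMulLog (gibbs ψ z)
      = (∑ i, softplus (ψ i)) * gibbs ψ z - gibbs ψ z * score ψ z := by
    intro z
    rw [Real.negMulLog, gibbs, Real.log_exp]
    ring
  simp only [h1]
  rw [Finset.sum_sub_distrib, ← Finset.mul_sum, sum_gibbs, Finset.sum_sub_distrib, ← mean_score,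
    mean, mul_one]

/-- The soft-decision capacity. -/
theorem isSoftCapacity (β : ℝ) :
    IsSoftCapacity β (rate (fun _ => 0) (fun t => t) (-β) / Real.log 2) := by
  have hlog : Real.log 2 ≠ 0 := (Real.log_pos one_lt_two).ne'
  intro τ
  have h1 : ∀ n : ℕ, entropyBits (softNoise β (τ n)) / n
      = ((∑ j, sample (fun t => softplus (-β * t) - -β * t * Real.sigmoid (-β * t)) n j) / n)
        / Real.log 2 := by
    intro n
    rw [entropyBits, funext (softNoise_eq_gibbs β (τ n)), sum_negMulLog_gibbs, div_right_comm]
    congr 2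
    exact Equiv.sum_comp (τ n) fun i => sample (fun t => softplus (-β * t)
      - -β * t * Real.sigmoid (-β * t)) n i
  simp only [h1]
  have h2 : Continuous fun t : ℝ => softplus (-β * t) - -β * t * Real.sigmoid (-β * t) := by
    fun_prop
  have h3 := (tendsto_sum_sample_div h2).div_const (Real.log 2)
  convert h3 using 2
  have h4 : Continuous fun t : ℝ => softplus (-β * t) := by fun_prop
  have h5 : Continuous fun t : ℝ => -β * t * Real.sigmoid (-β * t) := by fun_prop
  rw [intervalIntegral.integral_sub (h4.intervalIntegrable _ _) (h5.intervalIntegrable _ _), rate,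
    logPart_zero, logPart, meanScore]
  simp only [zero_add, mul_assoc, intervalIntegral.integral_const_mul]
  field_simp
  ring

/-- Hamming weight is invariant under permutations, so its law is the same as for the noise with
ranks in order. -/
theorem sum_hardNoise_mul (β : ℝ) {n : ℕ} (f : ℝ → ℝ) :
    ∑ z : Word n, hardNoise β z * f (score (sample (fun _ => 1) n) z)
      = mean (sample (fun t => -β * t) n) fun z => f (score (sample (fun _ => 1) n) z) := by
  simp only [hardNoise_eq_expect, Finset.expect_mul]
  rw [← Finset.expect_sum_comm]
  have h : ∀ τ : Equiv.Perm (Fin n),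
      ∑ z : Word n, softNoise β τ z * f (score (sample (fun _ => 1) n) z)
        = mean (sample (fun t => -β * t) n) fun z => f (score (sample (fun _ => 1) n) z) := by
    intro τ
    rw [← mean_comp_perm _ _ τ, mean]
    refine Finset.sum_congr rfl fun z _ => ?_
    rw [softNoise_eq_gibbs, ← score_comp_perm]
    rfl
  simp only [h, Fintype.expect_const]

theorem sum_hardNoise (β : ℝ) {n : ℕ} : ∑ z : Word n, hardNoise β z = 1 := by
  simpa [mean_const] using sum_hardNoise_mul β (n := n) fun _ => 1

theorem hardNoise_pos (β : ℝ) {n : ℕ} (z : Word n) : 0 < hardNoise β z := by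
  rw [hardNoise_eq_expect, Fintype.expect_eq_sum_div_card]
  refine div_pos (Finset.sum_pos (fun τ _ => ?_) Finset.univ_nonempty)
    (by exact_mod_cast Fintype.card_pos)
  rw [softNoise_eq_gibbs]
  exact gibbs_pos _ _

theorem hardNoise_le_one (β : ℝ) {n : ℕ} (z : Word n) : hardNoise β z ≤ 1 := by
  rw [← sum_hardNoise β (n := n)]
  exact Finset.single_le_sum (fun z _ => (hardNoise_pos β z).le) (Finset.mem_univ z)

/-- Gibbs' inequality. -/
theorem sum_negMulLog_le {α : Type*} [Fintype α] {p r : α → ℝ} (hp : ∀ z, 0 < p z)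
    (hr : ∀ z, 0 < r z) (h : ∑ z, r z ≤ ∑ z, p z) :
    ∑ z, Real.negMulLog (p z) ≤ ∑ z, p z * -Real.log (r z) := by
  have h1 : ∀ z, Real.negMulLog (p z) ≤ p z * -Real.log (r z) + (r z - p z) := by
    intro z
    have h2 := Real.log_le_sub_one_of_pos (div_pos (hr z) (hp z))
    rw [Real.log_div (hr z).ne' (hp z).ne'] at h2
    have h3 := mul_le_mul_of_nonneg_left h2 (hp z).le
    have h4 : p z * (r z / p z - 1) = r z - p z := by
      have := (hp z).ne'
      field_simp
    rw [Real.negMulLog]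
    linarith
  refine (Finset.sum_le_sum fun z _ => h1 z).trans ?_
  rw [Finset.sum_add_distrib, Finset.sum_sub_distrib]
  linarith

/-- Gibbs' inequality against the i.i.d. law with logit `-θ`, whose log-likelihood is affine in the
weight. -/
theorem sum_negMulLog_hardNoise_le (β θ : ℝ) (n : ℕ) :
    ∑ z : Word n, Real.negMulLog (hardNoise β z)
      ≤ n * softplus (-θ) + θ * ∑ i, Real.sigmoid (sample (fun t => -β * t) n i) := by
  have h1 := sum_negMulLog_le (fun z : Word n => hardNoise_pos β z)
    (fun z => gibbs_pos (fun i => -θ * sample (fun _ => 1) n i) z)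
    (by rw [sum_gibbs, sum_hardNoise])
  refine h1.trans_eq ?_
  have h2 : ∀ z : Word n, -Real.log (gibbs (fun i => -θ * sample (fun _ => 1) n i) z)
      = n * softplus (-θ) + θ * score (sample (fun _ => 1) n) z := by
    intro z
    rw [gibbs, Real.log_exp, score_mul]
    simp [sample]
  simp only [h2]
  rw [sum_hardNoise_mul β fun s => n * softplus (-θ) + θ * s, mean_add, mean_const,
    mean_const_mul, mean_score]
  simp [sample]

/-- Every word in the Hamming ball through `z` is at least as likely as `z`, and the total mass is
one. -/
theorem hardNoise_mul_prob_le {β : ℝ} (hβ : 0 < β) {n : ℕ} (z : Word n) :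
    hardNoise β z * (2 ^ n * prob (unifLogit n)
      {z' | score (sample (fun _ => 1) n) z' ≤ score (sample (fun _ => 1) n) z}) ≤ 1 := by
  classical
  rw [prob_unifLogit, mul_div_cancel₀ _ (by positivity), mul_comm, ← nsmul_eq_mul]
  refine le_of_le_of_eq ?_ (sum_hardNoise β (n := n))
  refine (Finset.card_nsmul_le_sum _ _ _ fun z' hz' => ?_).trans
    (Finset.sum_le_univ_sum_of_nonneg fun z => (hardNoise_pos β z).le)
  exact hardNoise_le_of_score_le hβ (Finset.mem_filter.1 hz').2

/-- Typical noise has weight near `n x`, and by `hardNoise_mul_prob_le` its likelihood is at most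
the reciprocal of the size of the Hamming ball of that radius, which the large deviation bound
estimates. -/
theorem eventually_le_sum_negMulLog_hardNoise {β θ : ℝ} (hβ : 0 < β)
    (hx : meanScore (fun _ => 1) (fun t => -β * t) = meanScore (fun _ => 1) (fun _ => 0 + -θ * 1))
    {η : ℝ} (hη : 0 < η) :
    ∀ᶠ n : ℕ in atTop, n * (Real.log 2 - rate (fun _ => 0) (fun _ => 1) (-θ) - 4 * η)
      ≤ ∑ z : Word n, Real.negMulLog (hardNoise β z) := by
  have h0 : Continuous fun _ : ℝ => (0 : ℝ) := continuous_const
  have hc : Continuous fun _ : ℝ => (1 : ℝ) := continuous_const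
  have hφ : Continuous fun t : ℝ => -β * t := by fun_prop
  have hcont : Continuous fun θ => rate (fun _ => 0) (fun _ => 1) (-θ) :=
    (continuous_rate h0 hc).comp continuous_neg
  obtain ⟨θ', hθ', hθη⟩ : ∃ θ', θ < θ' ∧
      rate (fun _ => 0) (fun _ => 1) (-θ') < rate (fun _ => 0) (fun _ => 1) (-θ) + η := by
    have h1 := (hcont.tendsto θ).eventually (gt_mem_nhds (lt_add_of_pos_right _ hη))
    exact ((h1.filter_mono nhdsWithin_le_nhds).and (self_mem_nhdsWithin (s := Set.Ioi θ))).exists.imp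
      fun _ h => ⟨h.2, h.1⟩
  set x := meanScore (fun _ => 1) (fun t => -β * t) with hxdef
  set x' := meanScore (fun _ => 1) (fun _ => 0 + -θ' * 1) with hx'def
  have hxx : x' < x := by
    rw [hx]
    exact strictMono_meanScore h0 hc (fun _ _ => zero_le_one) one_pos (neg_lt_neg hθ')
  obtain ⟨δ, hδ, hδx, hδθ⟩ := exists_pos_mul_le (-θ') (half_pos (sub_pos.2 hxx)) hη
  set h := Real.log 2 - rate (fun _ => 0) (fun _ => 1) (-θ) with hh
  obtain ⟨κ, hκ, -, hκh⟩ := exists_pos_mul_le h one_pos hη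
  filter_upwards [eventually_le_prob_window h0 hc (-θ') hδ hη,
    (tendsto_prob_deviation hφ hc hδ).eventually (gt_mem_nhds hκ)] with n hw hdev
  have hn0 : (0 : ℝ) ≤ n := Nat.cast_nonneg n
  have hnn : ∀ z : Word n, 0 ≤ Real.negMulLog (hardNoise β z) := fun z =>
    Real.negMulLog_nonneg (hardNoise_pos β z).le (hardNoise_le_one β z)
  -- A nonpositive target follows from nonnegativity of entropy; a positive one may be multiplied by
  -- the deviation probability.
  rcases le_or_gt (n * (h - 3 * η)) 0 with hv | hv
  · refine le_trans ?_ (Finset.sum_nonneg fun z _ => hnn z)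
    nlinarith
  let f : ℝ → ℝ := fun s => if n * δ ≤ |s - n * x| then 0 else n * (h - 3 * η)
  have hpt : ∀ z : Word n, hardNoise β z * f (score (sample (fun _ => 1) n) z)
      ≤ Real.negMulLog (hardNoise β z) := by
    intro z
    by_cases hz : n * δ ≤ |score (sample (fun _ => 1) n) z - n * x|
    · simpa [f, hz] using hnn z
    · simp only [f, hz, if_false]
      rw [Real.negMulLog, neg_mul, ← mul_neg]
      refine mul_le_mul_of_nonneg_left ?_ (hardNoise_pos β z).le
      have h1 : Real.exp (n * -(rate (fun _ => 0) (fun _ => 1) (-θ) + 3 * η))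
          ≤ prob (unifLogit n)
            {z' | score (sample (fun _ => 1) n) z' ≤ score (sample (fun _ => 1) n) z} := by
        refine le_trans (Real.exp_le_exp.2 ?_) (hw.trans (prob_mono _ fun z' hz' => ?_))
        · exact mul_le_mul_of_nonneg_left (by linarith) hn0
        · have h3 := (abs_lt.1 (not_le.1 hz)).1
          have h4 := (abs_lt.1 (show |score (sample (fun _ => 1) n) z' - n * x'| < n * δ
            from hz')).2
          have h5 : (n : ℝ) * (x' + δ + δ) ≤ n * x :=
            mul_le_mul_of_nonneg_left (by linarith) hn0
          show score (sample (fun _ => 1) n) z' ≤ score (sample (fun _ => 1) n) z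
          linarith
      have h2 : hardNoise β z * Real.exp (n * (h - 3 * η)) ≤ 1 := by
        refine le_trans (mul_le_mul_of_nonneg_left ?_ (hardNoise_pos β z).le)
          (hardNoise_mul_prob_le hβ z)
        refine le_trans (le_of_eq ?_) (mul_le_mul_of_nonneg_left h1 (by positivity))
        rw [← Real.exp_log (show (0 : ℝ) < 2 ^ n by positivity), Real.log_pow, ← Real.exp_add, hh]
        congr 1
        ring
      have h3 := Real.log_le_log (mul_pos (hardNoise_pos β z) (Real.exp_pos _)) h2
      rw [Real.log_mul (hardNoise_pos β z).ne' (Real.exp_pos _).ne', Real.log_exp,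
        Real.log_one] at h3
      linarith
  refine le_trans ?_ (Finset.sum_le_sum fun z _ => hpt z)
  rw [sum_hardNoise_mul β f]
  have hf : ∀ z : Word n, n * (h - 3 * η) * (1 - {z : Word n | n * δ ≤
      |score (sample (fun _ => 1) n) z - n * x|}.indicator 1 z)
        ≤ f (score (sample (fun _ => 1) n) z) := by
    intro z
    by_cases hz : n * δ ≤ |score (sample (fun _ => 1) n) z - n * x|
    · rw [Set.indicator_of_mem (by exact hz)]
      simp [f, hz]
    · rw [Set.indicator_of_notMem (by exact hz)]
      simp [f, hz]
  refine le_trans ?_ (mean_mono _ hf)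
  rw [mean_const_mul, mean_sub, mean_const]
  change _ ≤ n * (h - 3 * η) * (1 - prob _ _)
  have h6 : n * (h - 3 * η) * prob (sample (fun t => -β * t) n)
      {z | n * δ ≤ |score (sample (fun _ => 1) n) z - n * x|} ≤ n * η := by
    refine (mul_le_mul_of_nonneg_left hdev.le hv.le).trans ?_
    rw [mul_assoc]
    refine mul_le_mul_of_nonneg_left ?_ hn0
    have := le_abs_self h
    nlinarith
  linarith

/-- The hard-decision capacity. -/
theorem isHardCapacity {β θ : ℝ} (hβ : 0 < β)
    (hx : meanScore (fun _ => 1) (fun t => -β * t)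
      = meanScore (fun _ => 1) (fun _ => 0 + -θ * 1)) :
    IsHardCapacity β (rate (fun _ => 0) (fun _ => 1) (-θ) / Real.log 2) := by
  have hlog : Real.log 2 ≠ 0 := (Real.log_pos one_lt_two).ne'
  have hφ : Continuous fun t : ℝ => -β * t := by fun_prop
  have hval : softplus (-θ) + θ * meanScore (fun _ => 1) (fun t => -β * t)
      = Real.log 2 - rate (fun _ => 0) (fun _ => 1) (-θ) := by
    rw [hx, rate, logPart_zero]
    simp [logPart]
    ring
  have hup := ((tendsto_meanScore hφ (continuous_const (y := (1 : ℝ)))).const_mul θ).const_add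
    (softplus (-θ))
  rw [hval] at hup
  have key : Tendsto (fun n : ℕ => (∑ z : Word n, Real.negMulLog (hardNoise β z)) / n) atTop
      (𝓝 (Real.log 2 - rate (fun _ => 0) (fun _ => 1) (-θ))) := by
    refine tendsto_order.2 ⟨fun a ha => ?_, fun a ha => ?_⟩
    · filter_upwards [eventually_le_sum_negMulLog_hardNoise hβ hx
        (show 0 < (Real.log 2 - rate (fun _ => 0) (fun _ => 1) (-θ) - a) / 8 by linarith),
        eventually_gt_atTop 0] with n hn hn0
      have hn0' : (0 : ℝ) < n := by exact_mod_cast hn0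
      rw [lt_div_iff₀ hn0']
      nlinarith
    · filter_upwards [hup.eventually (gt_mem_nhds ha), eventually_gt_atTop 0] with n hn hn0
      have hn0' : (0 : ℝ) < n := by exact_mod_cast hn0
      refine lt_of_le_of_lt ?_ hn
      rw [div_le_iff₀ hn0']
      refine (sum_negMulLog_hardNoise_le β θ n).trans_eq ?_
      simp only [sample, one_mul]
      field_simp
  have h2 := key.div_const (Real.log 2)
  refine (h2.congr fun n => ?_).trans_eq ?_
  · rw [entropyBits, div_right_comm]
  · congr 1
    field_simp

/-! ### Relative entropy and the comparison of soft with hard -/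

theorem meanScore_add_mul {φ c v : ℝ → ℝ} (hφ : Continuous φ) (hc : Continuous c)
    (hv : Continuous v) (b : ℝ) :
    meanScore (fun t => φ t + b * c t) v = meanScore φ v + b * meanScore c v := by
  have h1 : Continuous fun t => φ t * Real.sigmoid (v t) := by fun_prop
  have h2 : Continuous fun t => b * (c t * Real.sigmoid (v t)) := by fun_prop
  rw [meanScore, meanScore, meanScore, ← intervalIntegral.integral_const_mul,
    ← intervalIntegral.integral_add (h1.intervalIntegrable _ _) (h2.intervalIntegrable _ _)]
  exact intervalIntegral.integral_congr fun t _ => by ring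

/-- The negative of the entropy rate of independent bits with logits `v (j / n)`. -/
noncomputable def negEntropy (v : ℝ → ℝ) : ℝ := meanScore v v - logPart v

theorem meanScore_sub_logPart_le {u v : ℝ → ℝ} (hu : Continuous u) (hv : Continuous v) :
    meanScore u v - logPart u ≤ negEntropy v := by
  have h1 : Continuous fun t => u t * Real.sigmoid (v t) - softplus (u t) := by fun_prop
  have h2 : Continuous fun t => v t * Real.sigmoid (v t) - softplus (v t) := by fun_prop
  rw [negEntropy, meanScore, meanScore, logPart, logPart,
    ← intervalIntegral.integral_sub (by apply Continuous.intervalIntegrable; fun_prop)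
      (by apply Continuous.intervalIntegrable; fun_prop),
    ← intervalIntegral.integral_sub (by apply Continuous.intervalIntegrable; fun_prop)
      (by apply Continuous.intervalIntegrable; fun_prop)]
  refine intervalIntegral.integral_mono_on zero_le_one (h1.intervalIntegrable _ _)
    (h2.intervalIntegrable _ _) fun t _ => ?_
  linarith [softplus_tangent_le (u t) (v t)]

theorem meanScore_sub_logPart_lt {u v : ℝ → ℝ} (hu : Continuous u) (hv : Continuous v)
    (h : ∃ t ∈ Set.Icc (0 : ℝ) 1, u t ≠ v t) :
    meanScore u v - logPart u < negEntropy v := by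
  rw [negEntropy, meanScore, meanScore, logPart, logPart,
    ← intervalIntegral.integral_sub (by apply Continuous.intervalIntegrable; fun_prop)
      (by apply Continuous.intervalIntegrable; fun_prop),
    ← intervalIntegral.integral_sub (by apply Continuous.intervalIntegrable; fun_prop)
      (by apply Continuous.intervalIntegrable; fun_prop)]
  obtain ⟨t, ht, hne⟩ := h
  refine intervalIntegral.integral_lt_integral_of_continuousOn_of_le_of_exists_lt zero_lt_one
    (by fun_prop) (by fun_prop) (fun t _ => ?_) ⟨t, ht, ?_⟩
  · linarith [softplus_tangent_le (u t) (v t)]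
  · linarith [softplus_tangent_lt hne]

/-- The right-hand side is the relative entropy per bit of the tilted law from the law with logits
`φ`. -/
theorem rate_eq {φ c : ℝ → ℝ} (hφ : Continuous φ) (hc : Continuous c) (b : ℝ) :
    rate φ c b = negEntropy (fun t => φ t + b * c t)
      - meanScore φ (fun t => φ t + b * c t) + logPart φ := by
  rw [negEntropy, meanScore_add_mul hφ hc (by fun_prop), rate]
  ring

theorem meanScore_zero (v : ℝ → ℝ) : meanScore (fun _ => 0) v = 0 := by
  simp [meanScore]

/-- Supporting lines of the rate function. -/
theorem tangent_le {φ c v : ℝ → ℝ} (hφ : Continuous φ) (hc : Continuous c) (hv : Continuous v)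
    (b : ℝ) : b * meanScore c v - (logPart (fun t => φ t + b * c t) - logPart φ)
      ≤ negEntropy v - meanScore φ v + logPart φ := by
  have h := meanScore_sub_logPart_le (u := fun t => φ t + b * c t) (by fun_prop) hv
  rw [meanScore_add_mul hφ hc hv] at h
  linarith

theorem tangent_lt {φ c v : ℝ → ℝ} (hφ : Continuous φ) (hc : Continuous c) (hv : Continuous v)
    {b : ℝ} (hne : ∃ t ∈ Set.Icc (0 : ℝ) 1, φ t + b * c t ≠ v t) :
    b * meanScore c v - (logPart (fun t => φ t + b * c t) - logPart φ)
      < negEntropy v - meanScore φ v + logPart φ := by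
  have h := meanScore_sub_logPart_lt (u := fun t => φ t + b * c t) (by fun_prop) hv hne
  rw [meanScore_add_mul hφ hc hv] at h
  linarith

/-- The supporting line of slope `-θ'` lies below the rate and is decreasing, and the mean score
drops as `θ'` grows to `θ`. -/
theorem rate_zero_lt {c : ℝ → ℝ} (hc : Continuous c) (hc0 : ∀ t ∈ Set.Icc (0 : ℝ) 1, 0 ≤ c t)
    (hc1 : 0 < c 1) {θ θ' : ℝ} (h0 : 0 < θ') (h : θ' < θ) :
    rate (fun _ => 0) c (-θ') < rate (fun _ => 0) c (-θ) := by
  have hz : Continuous fun _ : ℝ => (0 : ℝ) := continuous_const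
  have h1 := tangent_le hz hc (v := fun t => 0 + -θ * c t) (by fun_prop) (-θ')
  have h2 : meanScore c (fun t => 0 + -θ * c t) < meanScore c (fun t => 0 + -θ' * c t) :=
    strictMono_meanScore hz hc hc0 hc1 (neg_lt_neg h)
  rw [rate_eq hz hc (-θ)]
  refine lt_of_lt_of_le ?_ h1
  rw [rate]
  nlinarith

theorem continuous_noise (β : ℝ) : Continuous fun t : ℝ => -β * t := by fun_prop

/-- The noise logits are a multiple of the rank weight, so tilted noise and tilted guesses form one
family, and matching mean scores means matching laws. -/
theorem noise_tilt (β θ : ℝ) :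
    (fun t : ℝ => -β * t + (β - θ) * t) = fun t => 0 + -θ * t := by
  funext t
  ring

/-- Among laws with a given mean number of flips, constant logits are closest to uniform, and the
noise logits are not constant. -/
theorem hard_rate_lt_soft_rate {β θ : ℝ} (hβ : 0 < β)
    (hx : meanScore (fun _ => 1) (fun t => -β * t)
      = meanScore (fun _ => 1) (fun _ => 0 + -θ * 1)) :
    rate (fun _ => 0) (fun _ => 1) (-θ) < rate (fun _ => 0) (fun t => t) (-β) := by
  have hz : Continuous fun _ : ℝ => (0 : ℝ) := continuous_const
  have hone : Continuous fun _ : ℝ => (1 : ℝ) := continuous_const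
  have h1 := tangent_lt hz hone (v := fun t => 0 + -β * t) (by fun_prop) (b := -θ) (by
    by_cases h : θ = 0
    · exact ⟨1, by simp, by simp [h, hβ.ne']⟩
    · exact ⟨0, by simp, by simp [h]⟩)
  rw [rate_eq hz continuous_id']
  refine lt_of_eq_of_lt ?_ h1
  rw [rate, ← hx]
  simp only [zero_add]

/-- The error exponent is strictly larger with soft-decision decoding. -/
theorem hard_error_rate_lt {β R a θ ρ θs ρs : ℝ} (hβ : 0 < β)
    (hρ0 : 0 ≤ ρ) (hρ1 : ρ ≤ 1) (ha : a = ρ * θ) (hθ : 0 < θ)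
    (hx : meanScore (fun _ => 1) (fun t => -β * t + a * 1)
      = meanScore (fun _ => 1) (fun _ => 0 + -θ * 1))
    (hs : β - θs = ρs * θs)
    (hRs : rate (fun _ => 0) (fun t => t) (-θs) = R ∨
      ρs = 1 ∧ R ≤ rate (fun _ => 0) (fun t => t) (-θs))
    (hR : R < rate (fun _ => 0) (fun t => t) (-β)) :
    rate (fun t => -β * t) (fun _ => 1) a + ρ * (rate (fun _ => 0) (fun _ => 1) (-θ) - R)
      < rate (fun t => -β * t) (fun t => t) (β - θs)
        + ρs * (rate (fun _ => 0) (fun t => t) (-θs) - R) := by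
  have hz : Continuous fun _ : ℝ => (0 : ℝ) := continuous_const
  have hone : Continuous fun _ : ℝ => (1 : ℝ) := continuous_const
  have hφ := continuous_noise β
  have hv : Continuous fun t : ℝ => 0 + -θs * t := by fun_prop
  -- This lets the hard `ρ` multiply the soft bracket: the bracket vanishes, or it is nonnegative
  -- and `ρ ≤ 1 = ρs`.
  have hle : ρ * (rate (fun _ => 0) (fun t => t) (-θs) - R)
      ≤ ρs * (rate (fun _ => 0) (fun t => t) (-θs) - R) := by
    rcases hRs with h | ⟨h, h'⟩
    · rw [h]
      simp
    · rw [h]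
      nlinarith
  refine lt_of_lt_of_le ?_ (add_le_add_right hle _)
  have t1 := tangent_le hφ hone hv a
  have t2 := tangent_lt hz hone hv (b := -θ) ⟨0, by simp, by simp [hθ.ne']⟩
  rw [rate_eq hφ continuous_id', noise_tilt, rate_eq hz continuous_id', rate, rate, ← hx]
  rw [meanScore_zero] at t2 ⊢
  set m := meanScore (fun _ => 1) (fun t => 0 + -θs * t)
  set x := meanScore (fun _ => 1) (fun t => -β * t + a * 1)
  -- Both at `x` and at `m`, the noise term and `ρ` times the guess term have cancelling linear
  -- parts, so the two lines can be added with neither mean score known.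
  have e1 : a * x = ρ * θ * x := by rw [ha]
  have e2 : a * m = ρ * θ * m := by rw [ha]
  -- For `ρ = 0` the strict guess inequality has weight zero. Then `a = 0`, and strictness comes
  -- from the noise: `θs = β` would put `R` at the soft capacity, or force `ρs = 0`.
  rcases hρ0.eq_or_lt with h0 | h0
  · have ha0 : a = 0 := by rw [ha, ← h0, zero_mul]
    have hne : θs ≠ β := by
      intro h
      have h1 : ρs = 0 := by
        rw [h, sub_self] at hs
        exact (mul_eq_zero.1 hs.symm).resolve_right hβ.ne'
      rcases hRs with h2 | ⟨h2, -⟩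
      · rw [h] at h2
        exact hR.ne' h2
      · rw [h1] at h2
        exact zero_ne_one h2
    have t1' := tangent_lt hφ hone hv (b := a) ⟨1, by simp, by simpa [ha0] using hne.symm⟩
    rw [← h0] at e1 e2 ⊢
    linarith
  · have t3 := mul_lt_mul_of_pos_left t2 h0
    linarith

/-- The success exponent is strictly smaller with soft-decision decoding. -/
theorem soft_success_rate_lt {β R a θ θs : ℝ} (hβ : 0 < β) (ha : a < 0)
    (hx : meanScore (fun _ => 1) (fun t => -β * t + a * 1)
      = meanScore (fun _ => 1) (fun _ => 0 + -θ * 1))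
    (hRθ : rate (fun _ => 0) (fun _ => 1) (-θ) = R) (hs : β ≤ θs)
    (hRs : rate (fun _ => 0) (fun t => t) (-θs) = R) :
    rate (fun t => -β * t) (fun t => t) (β - θs) < rate (fun t => -β * t) (fun _ => 1) a := by
  have hz : Continuous fun _ : ℝ => (0 : ℝ) := continuous_const
  have hone : Continuous fun _ : ℝ => (1 : ℝ) := continuous_const
  have hid : Continuous fun t : ℝ => t := continuous_id
  have hφ := continuous_noise β
  have hψ : Continuous fun t : ℝ => -β * t + a * 1 := by fun_prop
  have t1 := tangent_lt hz hone hψ (b := -θ) (by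
    by_cases h : -θ = a
    · exact ⟨1, by simp, by simp [h, hβ.ne']⟩
    · exact ⟨0, by simp, by simpa using h⟩)
  have t2 := tangent_lt hz hid hψ (b := -θs) ⟨0, by simp, by simpa using ha.ne'⟩
  have hm : ∀ v, meanScore (fun t => -β * t) v = -β * meanScore (fun t => t) v := by
    intro v
    simp only [meanScore, mul_assoc, intervalIntegral.integral_const_mul]
  have hRs' := hRs
  rw [rate_eq hz hid, meanScore_zero] at hRs
  rw [rate] at hRs' hRθ
  rw [← hx] at hRθ
  rw [rate_eq hφ hid, noise_tilt, rate_eq hφ hone, hm, hm]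
  rw [meanScore_zero] at t1 t2
  set xs := meanScore (fun t => t) (fun t => 0 + -θs * t)
  set x := meanScore (fun t => t) (fun t => -β * t + a * 1)
  -- If the hard optimum has the larger mean rank score, it suffices that it is farther than `R`
  -- from uniform (`t1`). Otherwise the soft line of slope `-θs` (`t2`) compensates the smaller
  -- score, because `β ≤ θs`.
  rcases le_total xs x with h | h
  · nlinarith
  · nlinarith

/-! ### Solving for the tilting parameters -/

theorem meanScore_one_const (u : ℝ) : meanScore (fun _ => 1) (fun _ => u) = Real.sigmoid u := by
  simp [meanScore]

theorem meanScore_one_le {u v : ℝ → ℝ} (hu : Continuous u) (hv : Continuous v)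
    (h : ∀ t ∈ Set.Icc (0 : ℝ) 1, u t ≤ v t) :
    meanScore (fun _ => 1) u ≤ meanScore (fun _ => 1) v :=
  intervalIntegral.integral_mono_on zero_le_one
    (by apply Continuous.intervalIntegrable; fun_prop)
    (by apply Continuous.intervalIntegrable; fun_prop)
    fun t ht => by simpa using Real.sigmoid_le (h t ht)

theorem meanScore_one_pos {u : ℝ → ℝ} (hu : Continuous u) : 0 < meanScore (fun _ => 1) u :=
  intervalIntegral.intervalIntegral_pos_of_pos (by apply Continuous.intervalIntegrable; fun_prop)
    (fun t => by simpa using Real.sigmoid_pos (u t)) zero_lt_one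

theorem meanScore_noise_lt {β : ℝ} (hβ : 0 < β) :
    meanScore (fun _ => 1) (fun t => -β * t) < Real.sigmoid 0 := by
  rw [← meanScore_one_const]
  refine intervalIntegral.integral_lt_integral_of_continuousOn_of_le_of_exists_lt zero_lt_one
    (by fun_prop) (by fun_prop) (fun t ht => ?_) ⟨1, by simp, ?_⟩
  · simpa using Real.sigmoid_le (show -β * t ≤ 0 by nlinarith [ht.1])
  · simpa using Real.sigmoid_lt (show -β * 1 < 0 by linarith)

theorem exists_pos_sigmoid_neg_eq {p : ℝ} (h0 : 0 < p) (h1 : p < Real.sigmoid 0) :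
    ∃ θ, 0 < θ ∧ Real.sigmoid (-θ) = p := by
  obtain ⟨u, hu⟩ : p ∈ Set.range Real.sigmoid := by
    rw [Real.range_sigmoid]
    exact ⟨h0, h1.trans (Real.sigmoid_lt_one 0)⟩
  rw [← hu, Real.sigmoid_lt_iff] at h1
  exact ⟨-u, by linarith, by rw [neg_neg, hu]⟩

theorem binEntropy_sigmoid (u : ℝ) :
    Real.binEntropy (Real.sigmoid u) = softplus u - u * Real.sigmoid u := by
  have h1 : Real.log (Real.sigmoid u) = u - softplus u := by
    rw [sigmoid_eq_exp_div, Real.log_div (Real.exp_pos u).ne' (one_add_exp_pos u).ne',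
      Real.log_exp, softplus]
  have h2 : Real.log (1 - Real.sigmoid u) = -softplus u := by
    have : 1 - Real.sigmoid u = (1 + Real.exp u)⁻¹ := by
      rw [sigmoid_eq_exp_div]
      have := one_add_exp_pos u
      field_simp
      ring
    rw [this, Real.log_inv, softplus]
  rw [Real.binEntropy, Real.log_inv, Real.log_inv, h1, h2]
  ring

theorem rate_zero_one (θ : ℝ) : rate (fun _ => 0) (fun _ => 1) (-θ)
    = Real.log 2 - Real.binEntropy (Real.sigmoid (-θ)) := by
  rw [binEntropy_sigmoid, rate, logPart_zero, meanScore_one_const]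
  simp [logPart]
  ring

/-- The fixed point `m a₁ = σ(-a₁)` is the case `a = θ`, `ρ = 1`, and determines the critical rate.
Above that rate, `a` moves from `a₁` down to `0` until the guess rate equals `R`; then `a ≤ a₁ ≤ θ`,
so `ρ = a / θ` is at most one. -/
theorem exists_hard_error_parameters {β θ₀ R : ℝ} (hβ : 0 < β)
    (hx : meanScore (fun _ => 1) (fun t => -β * t) = meanScore (fun _ => 1) (fun _ => 0 + -θ₀ * 1))
    (hR : R ≤ rate (fun _ => 0) (fun _ => 1) (-θ₀)) :
    ∃ a θ ρ, 0 ≤ ρ ∧ ρ ≤ 1 ∧ a = ρ * θ ∧ 0 < θ ∧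
      meanScore (fun _ => 1) (fun t => -β * t + a * 1)
        = meanScore (fun _ => 1) (fun _ => 0 + -θ * 1) ∧
      (rate (fun _ => 0) (fun _ => 1) (-θ) = R ∨
        ρ = 1 ∧ R ≤ rate (fun _ => 0) (fun _ => 1) (-θ)) := by
  have hφ := continuous_noise β
  have hone : Continuous fun _ : ℝ => (1 : ℝ) := continuous_const
  set m : ℝ → ℝ := fun a => meanScore (fun _ => 1) (fun t => -β * t + a * 1) with hm
  have hmc : Continuous m := continuous_meanScore hφ hone
  have hmono : StrictMono m := strictMono_meanScore hφ hone (fun _ _ => zero_le_one) one_pos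
  have hm0 : m 0 = meanScore (fun _ => 1) (fun t => -β * t) := by
    simp only [hm, zero_mul, add_zero]
  have hmlt : m 0 < Real.sigmoid 0 := hm0.trans_lt (meanScore_noise_lt hβ)
  have hsig : ∀ θ, meanScore (fun _ => 1) (fun _ => 0 + -θ * 1) = Real.sigmoid (-θ) := by
    intro θ
    rw [meanScore_one_const]
    simp
  obtain ⟨a₁, ⟨ha₁, -⟩, hfix⟩ : ∃ a₁ ∈ Set.Icc 0 β, m a₁ - Real.sigmoid (-a₁) = 0 := by
    refine intermediate_value_Icc hβ.le (by fun_prop) ⟨?_, ?_⟩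
    · simpa using hmlt.le
    · have h1 := meanScore_one_le (u := fun _ => -β) (v := fun t => -β * t + β * 1)
        (by fun_prop) (by fun_prop) fun t ht => by nlinarith [ht.2]
      rw [meanScore_one_const] at h1
      exact sub_nonneg.2 h1
  have hfix' : m a₁ = Real.sigmoid (-a₁) := sub_eq_zero.1 hfix
  have ha₁0 : 0 < a₁ := by
    rcases ha₁.eq_or_lt with h | h
    · rw [← h, neg_zero] at hfix'
      exact absurd hfix' hmlt.ne
    · exact h
  by_cases hcase : R ≤ rate (fun _ => 0) (fun _ => 1) (-a₁)
  · exact ⟨a₁, a₁, 1, zero_le_one, le_rfl, (one_mul _).symm, ha₁0, hfix'.trans (hsig a₁).symm,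
      Or.inr ⟨rfl, hcase⟩⟩
  · push Not at hcase
    rw [rate_zero_one, ← hfix'] at hcase
    rw [rate_zero_one, ← hsig, ← hx, ← hm0] at hR
    obtain ⟨a, ha, haR⟩ : ∃ a ∈ Set.Icc 0 a₁, Real.log 2 - Real.binEntropy (m a) = R :=
      intermediate_value_Icc' ha₁ (by fun_prop) ⟨hcase.le, hR⟩
    have hma : m a ≤ m a₁ := hmono.monotone ha.2
    obtain ⟨θ, hθ, hθa⟩ := exists_pos_sigmoid_neg_eq (p := m a)
      (meanScore_one_pos (by fun_prop)) (hma.trans_lt (by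
        rw [hfix', Real.sigmoid_lt_iff]
        linarith))
    have hle : a ≤ θ := by
      rw [← hθa, hfix', Real.sigmoid_le_iff] at hma
      linarith [ha.2]
    refine ⟨a, θ, a / θ, div_nonneg ha.1 hθ.le, (div_le_one hθ).2 hle, ?_, hθ,
      hθa.symm.trans (hsig θ).symm, Or.inl ?_⟩
    · field_simp
    · rw [rate_zero_one, hθa, haR]

/-- As `a → -∞` the flips disappear and the guess rate tends to `log 2`, while `a = 0` gives the
hard capacity; the rates in between are attained by continuity. -/
theorem exists_hard_success_parameters {β θ₀ R : ℝ} (hβ : 0 < β)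
    (hx : meanScore (fun _ => 1) (fun t => -β * t) = meanScore (fun _ => 1) (fun _ => 0 + -θ₀ * 1))
    (hR : rate (fun _ => 0) (fun _ => 1) (-θ₀) < R) (hR2 : R < Real.log 2) :
    ∃ a θ, a < 0 ∧ 0 < θ ∧
      meanScore (fun _ => 1) (fun t => -β * t + a * 1)
        = meanScore (fun _ => 1) (fun _ => 0 + -θ * 1) ∧
      rate (fun _ => 0) (fun _ => 1) (-θ) = R := by
  have hφ := continuous_noise β
  have hone : Continuous fun _ : ℝ => (1 : ℝ) := continuous_const
  set m : ℝ → ℝ := fun a => meanScore (fun _ => 1) (fun t => -β * t + a * 1) with hm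
  have hmc : Continuous m := continuous_meanScore hφ hone
  have hmono : StrictMono m := strictMono_meanScore hφ hone (fun _ _ => zero_le_one) one_pos
  have hm0 : m 0 = meanScore (fun _ => 1) (fun t => -β * t) := by
    simp only [hm, zero_mul, add_zero]
  have hmlt : m 0 < Real.sigmoid 0 := hm0.trans_lt (meanScore_noise_lt hβ)
  have hsig : ∀ θ, meanScore (fun _ => 1) (fun _ => 0 + -θ * 1) = Real.sigmoid (-θ) := by
    intro θ
    rw [meanScore_one_const]
    simp
  have hpos : ∀ a, 0 < m a := fun a => meanScore_one_pos (by fun_prop)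
  have hlim : Tendsto m atBot (𝓝 0) := by
    refine squeeze_zero (fun a => (hpos a).le) (fun a => ?_) Real.tendsto_sigmoid_atBot
    have h1 := meanScore_one_le (u := fun t => -β * t + a * 1) (v := fun _ => a)
      (by fun_prop) (by fun_prop) fun t ht => by nlinarith [ht.1]
    rwa [meanScore_one_const] at h1
  have hlim2 : Tendsto (fun a => Real.log 2 - Real.binEntropy (m a)) atBot (𝓝 (Real.log 2)) := by
    have := (Real.binEntropy_continuous.tendsto 0).comp hlim
    rw [Real.binEntropy_zero] at this
    simpa using this.const_sub (Real.log 2)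
  obtain ⟨a₁, ha₁R, ha₁⟩ := ((hlim2.eventually (lt_mem_nhds hR2)).and
    (eventually_le_atBot (0 : ℝ))).exists
  rw [rate_zero_one, ← hsig, ← hx, ← hm0] at hR
  obtain ⟨a, ha, haR⟩ : ∃ a ∈ Set.Icc a₁ 0, Real.log 2 - Real.binEntropy (m a) = R :=
    intermediate_value_Icc' ha₁ (by fun_prop) ⟨hR.le, ha₁R.le⟩
  have ha0 : a < 0 := lt_of_le_of_ne ha.2 fun h => by
    rw [h] at haR
    exact hR.ne haR
  obtain ⟨θ, hθ, hθa⟩ := exists_pos_sigmoid_neg_eq (hpos a) ((hmono ha0).trans hmlt)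
  exact ⟨a, θ, ha0, hθ, hθa.symm.trans (hsig θ).symm, by rw [rate_zero_one, hθa, haR]⟩

/-- With `a = β - θ`, the critical case `ρ = 1` is `θ = β / 2`, and capacity is `θ = β`, where `ρ =
0`. -/
theorem exists_soft_error_parameters {β R : ℝ} (hβ : 0 < β)
    (hR : R ≤ rate (fun _ => 0) (fun t => t) (-β)) :
    ∃ θ ρ, 0 ≤ ρ ∧ ρ ≤ 1 ∧ β - θ = ρ * θ ∧ 0 < θ ∧
      (rate (fun _ => 0) (fun t => t) (-θ) = R ∨
        ρ = 1 ∧ R ≤ rate (fun _ => 0) (fun t => t) (-θ)) := by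
  by_cases hcase : R ≤ rate (fun _ => 0) (fun t => t) (-(β / 2))
  · exact ⟨β / 2, 1, zero_le_one, le_rfl, by ring, half_pos hβ, Or.inr ⟨rfl, hcase⟩⟩
  · push Not at hcase
    have hcont : Continuous fun θ => rate (fun _ => 0) (fun t => t) (-θ) :=
      (continuous_rate continuous_const continuous_id).comp continuous_neg
    obtain ⟨θ, hθ, hθR⟩ : ∃ θ ∈ Set.Icc (β / 2) β, rate (fun _ => 0) (fun t => t) (-θ) = R :=
      intermediate_value_Icc (by linarith) hcont.continuousOn ⟨hcase.le, hR⟩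
    have hθ0 : 0 < θ := by linarith [hθ.1]
    refine ⟨θ, (β - θ) / θ, div_nonneg (by linarith [hθ.2]) hθ0.le,
      (div_le_one hθ0).2 (by linarith [hθ.1]), ?_, hθ0, Or.inl hθR⟩
    field_simp

theorem integral_one_add_mul_exp_neg_le {θ : ℝ} (hθ : 0 < θ) :
    ∫ t in (0 : ℝ)..1, (1 + θ * t) * Real.exp (-θ * t) ≤ 2 / θ := by
  have hd : ∀ t ∈ Set.uIcc (0 : ℝ) 1, HasDerivAt
      (fun t => -(2 + θ * t) * Real.exp (-θ * t) / θ) ((1 + θ * t) * Real.exp (-θ * t)) t := by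
    intro t _
    have h1 : HasDerivAt (fun t => -(2 + θ * t)) (-θ) t := by
      exact (((hasDerivAt_id t).const_mul θ).const_add 2).fun_neg.congr_deriv (by simp)
    have h2 : HasDerivAt (fun t => Real.exp (-θ * t)) (Real.exp (-θ * t) * -θ) t := by
      simpa using ((hasDerivAt_id t).const_mul (-θ)).exp
    refine ((h1.mul h2).div_const θ).congr_deriv ?_
    field_simp
    ring
  rw [intervalIntegral.integral_eq_sub_of_hasDerivAt hd
    (by apply Continuous.intervalIntegrable; fun_prop)]
  have : 0 ≤ (2 + θ * 1) * Real.exp (-θ * 1) / θ := by positivity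
  have h3 : -(2 + θ * 0) * Real.exp (-θ * 0) / θ = -(2 / θ) := by
    simp
    ring
  rw [h3]
  have h4 : -(2 + θ * 1) * Real.exp (-θ * 1) / θ = -((2 + θ * 1) * Real.exp (-θ * 1) / θ) := by
    ring
  rw [h4]
  linarith

/-- A bit with logit `-θ t` has entropy at most `(1 + θ t) exp (-θ t)`, because both its mean and
its softplus are at most `exp (-θ t)`. Hence the rate approaches `log 2` for large `θ`. -/
theorem log_two_sub_le_soft_rate {θ : ℝ} (hθ : 0 < θ) :
    Real.log 2 - 2 / θ ≤ rate (fun _ => 0) (fun t => t) (-θ) := by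
  have hv : Continuous fun t : ℝ => 0 + -θ * t := by fun_prop
  have h := integral_one_add_mul_exp_neg_le hθ
  rw [rate_eq continuous_const continuous_id', meanScore_zero, logPart_zero, negEntropy, meanScore,
    logPart, ← intervalIntegral.integral_sub (by apply Continuous.intervalIntegrable; fun_prop)
      (by apply Continuous.intervalIntegrable; fun_prop)]
  have h1 : ∫ t in (0 : ℝ)..1, -((1 + θ * t) * Real.exp (-θ * t)) ≤ ∫ t in (0 : ℝ)..1,
      ((0 + -θ * t) * Real.sigmoid (0 + -θ * t) - softplus (0 + -θ * t)) := by
    refine intervalIntegral.integral_mono_on zero_le_one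
      (by apply Continuous.intervalIntegrable; fun_prop)
      (by apply Continuous.intervalIntegrable; fun_prop) fun t ht => ?_
    rw [zero_add]
    have e0 := Real.exp_pos (-θ * t)
    have e1 : Real.sigmoid (-θ * t) ≤ Real.exp (-θ * t) := by
      rw [sigmoid_eq_exp_div]
      exact div_le_self e0.le (by linarith)
    have e2 : softplus (-θ * t) ≤ Real.exp (-θ * t) := by
      have := Real.log_le_sub_one_of_pos (one_add_exp_pos (-θ * t))
      rw [softplus]
      linarith
    have e3 : 0 ≤ θ * t := mul_nonneg hθ.le ht.1
    nlinarith
  rw [intervalIntegral.integral_neg] at h1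
  linarith

theorem exists_soft_success_parameter {β R : ℝ} (hβ : 0 < β)
    (hR : rate (fun _ => 0) (fun t => t) (-β) ≤ R) (hR2 : R < Real.log 2) :
    ∃ θ, β ≤ θ ∧ rate (fun _ => 0) (fun t => t) (-θ) = R := by
  have hcont : Continuous fun θ => rate (fun _ => 0) (fun t => t) (-θ) :=
    (continuous_rate continuous_const continuous_id).comp continuous_neg
  have hd : 0 < Real.log 2 - R := sub_pos.2 hR2
  set B := max β (2 / (Real.log 2 - R)) with hB
  have hB0 : 0 < B := lt_max_of_lt_left hβ
  have h1 := log_two_sub_le_soft_rate hB0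
  have h2 : 2 / B ≤ Real.log 2 - R := by
    have := le_max_right β (2 / (Real.log 2 - R))
    rw [← hB, div_le_iff₀ hd] at this
    rw [div_le_iff₀ hB0]
    linarith
  obtain ⟨θ, hθ, hθR⟩ : ∃ θ ∈ Set.Icc β B, rate (fun _ => 0) (fun t => t) (-θ) = R :=
    intermediate_value_Icc (le_max_left _ _) hcont.continuousOn ⟨hR, by linarith⟩
  exact ⟨θ, hθ.1, hθR⟩

/-! ### Assembly of the exponents -/

theorem IsCodeSize.tendsto_log {R : ℝ} {M : ℕ → ℕ} (h : IsCodeSize R M) :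
    Tendsto (fun n : ℕ => Real.log (M n) / n) atTop (𝓝 (R * Real.log 2)) := by
  refine (h.2.2.mul_const (Real.log 2)).congr fun n => ?_
  rw [Real.logb]
  have := (Real.log_pos one_lt_two).ne'
  field_simp

theorem exists_error_exponents {β θ₀ R : ℝ} (hβ : 0 < β)
    (hx : meanScore (fun _ => 1) (fun t => -β * t) = meanScore (fun _ => 1) (fun _ => 0 + -θ₀ * 1))
    (hR : R * Real.log 2 ≤ rate (fun _ => 0) (fun _ => 1) (-θ₀)) :
    ∃ eN eZ, IsSoftErrorExponent β R eN ∧ IsHardErrorExponent β R eZ ∧ eZ < eN := by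
  have hφ := continuous_noise β
  have hone : Continuous fun _ : ℝ => (1 : ℝ) := continuous_const
  have hlt := hR.trans_lt (hard_rate_lt_soft_rate hβ hx)
  obtain ⟨a, θ, ρ, hρ0, hρ1, ha, hθ, hxa, hRθ⟩ := exists_hard_error_parameters hβ hx hR
  obtain ⟨θs, ρs, hρs0, hρs1, has, hθs, hRs⟩ := exists_soft_error_parameters hβ hlt.le
  refine ⟨_, _, fun M hM D hD => (hasRate_error hφ continuous_id' (fun t ht => ht.1) one_pos
    hρs0 hρs1 has hθs (by rw [noise_tilt]) hRs hM.2.1 hM.tendsto_log ?_ ?_).hasExponent,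
    fun M hM D hD => (hasRate_error hφ hone (fun _ _ => zero_le_one) one_pos
    hρ0 hρ1 ha hθ hxa hRθ hM.2.1 hM.tendsto_log ?_ ?_).hasExponent,
    div_lt_div_of_pos_right (hard_error_rate_lt hβ hρ0 hρ1 ha hθ hxa has hRs hlt)
      (Real.log_pos one_lt_two)⟩
  all_goals
    intro n
    rw [errorProb_eq_one_sub β (hM.1 n)]
  · exact sub_le_sub_left (successProb_bounds (hM.1 n) (hD n |>.isMinScore hβ)).2 _
  · exact sub_le_sub_left (successProb_bounds (hM.1 n) (hD n |>.isMinScore hβ)).1 _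
  · exact sub_le_sub_left (successProb_bounds (hM.1 n) (hD n |>.isMinScore hβ)).2 _
  · exact sub_le_sub_left (successProb_bounds (hM.1 n) (hD n |>.isMinScore hβ)).1 _

theorem exists_success_exponents {β θ₀ R : ℝ} (hβ : 0 < β)
    (hx : meanScore (fun _ => 1) (fun t => -β * t) = meanScore (fun _ => 1) (fun _ => 0 + -θ₀ * 1))
    (hR : rate (fun _ => 0) (fun t => t) (-β) ≤ R * Real.log 2) (hR1 : R < 1) :
    ∃ sN sZ, IsSoftSuccessExponent β R sN ∧ IsHardSuccessExponent β R sZ ∧ sN < sZ := by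
  have hφ := continuous_noise β
  have hone : Continuous fun _ : ℝ => (1 : ℝ) := continuous_const
  have hlog := Real.log_pos one_lt_two
  have hR2 : R * Real.log 2 < Real.log 2 := by nlinarith
  obtain ⟨a, θ, ha, hθ, hxa, hRθ⟩ := exists_hard_success_parameters hβ hx
    ((hard_rate_lt_soft_rate hβ hx).trans_le hR) hR2
  obtain ⟨θs, hθs, hRs⟩ := exists_soft_success_parameter hβ hR hR2
  refine ⟨_, _, fun M hM D hD => (hasRate_success hφ continuous_id' (fun t ht => ht.1) one_pos
    (sub_nonpos.2 hθs) (hβ.trans_le hθs) (by rw [noise_tilt]) hRs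
    (fun θ' => rate_zero_lt continuous_id' (fun t ht => ht.1) one_pos)
    hM.2.1 hM.tendsto_log ?_ ?_).hasExponent,
    fun M hM D hD => (hasRate_success hφ hone (fun _ _ => zero_le_one) one_pos ha.le hθ hxa hRθ
    (fun θ' => rate_zero_lt hone (fun _ _ => zero_le_one) one_pos)
    hM.2.1 hM.tendsto_log ?_ ?_).hasExponent,
    div_lt_div_of_pos_right (soft_success_rate_lt hβ ha hxa hRθ hθs hRs) hlog⟩
  · exact fun n => (successProb_bounds (hM.1 n) (hD n |>.isMinScore hβ)).1
  · exact fun n => (successProb_bounds (hM.1 n) (hD n |>.isMinScore hβ)).2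
  · exact fun n => (successProb_bounds (hM.1 n) (hD n |>.isMinScore hβ)).1
  · exact fun n => (successProb_bounds (hM.1 n) (hD n |>.isMinScore hβ)).2

end LRC

theorem mainTheorem1 (β : ℝ) (hβ : 0 < β) :
    ∃ C_N C_Z : ℝ, LRC.IsSoftCapacity β C_N ∧ LRC.IsHardCapacity β C_Z ∧
      ∃ ε_N ε_Z s_N s_Z : ℝ → ℝ,
        (∀ R ∈ Set.Icc 0 C_Z,
          LRC.IsSoftErrorExponent β R (ε_N R) ∧ LRC.IsHardErrorExponent β R (ε_Z R) ∧
            ε_Z R < ε_N R) ∧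
        (∀ R ∈ Set.Ico C_N 1,
          LRC.IsSoftSuccessExponent β R (s_N R) ∧ LRC.IsHardSuccessExponent β R (s_Z R) ∧
            s_N R < s_Z R) := by
  have hlog := Real.log_pos one_lt_two
  -- The constant logit `-θ₀` has the mean flip probability of the channel; it determines the hard
  -- capacity.
  obtain ⟨θ₀, -, hθ₀⟩ := LRC.exists_pos_sigmoid_neg_eq
    (LRC.meanScore_one_pos (LRC.continuous_noise β)) (LRC.meanScore_noise_lt hβ)
  have hx : LRC.meanScore (fun _ => 1) (fun t => -β * t)
      = LRC.meanScore (fun _ => 1) (fun _ => 0 + -θ₀ * 1) := by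
    rw [LRC.meanScore_one_const, ← hθ₀]
    simp
  have hE : ∀ R ∈ Set.Icc 0 (LRC.rate (fun _ => 0) (fun _ => 1) (-θ₀) / Real.log 2), ∃ eN eZ,
      LRC.IsSoftErrorExponent β R eN ∧ LRC.IsHardErrorExponent β R eZ ∧ eZ < eN :=
    fun R hR => LRC.exists_error_exponents hβ hx ((le_div_iff₀ hlog).1 hR.2)
  have hS : ∀ R ∈ Set.Ico (LRC.rate (fun _ => 0) (fun t => t) (-β) / Real.log 2) 1, ∃ sN sZ,
      LRC.IsSoftSuccessExponent β R sN ∧ LRC.IsHardSuccessExponent β R sZ ∧ sN < sZ :=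
    fun R hR => LRC.exists_success_exponents hβ hx ((div_le_iff₀ hlog).1 hR.1) hR.2
  choose! ε_N ε_Z hε using hE
  choose! s_N s_Z hs using hS
  exact ⟨_, _, LRC.isSoftCapacity β, LRC.isHardCapacity hβ hx, ε_N, ε_Z, s_N, s_Z, hε, hs⟩
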